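/- Let $\Omega\subset\mathbb{R}^n$ be a bounded open set, let $H=L^2(\Omega)$ (real or complex), and let $A$ be a positive ($\langle A\varphi,\varphi\rangle\ge 0$), self-adjoint, densely defined, in general unbounded operator on $H$ with discrete spectrum (the spectrum consists of isolated eigenvalues of finite multiplicity) and resolution of the identity $E_\lambda$. For $s\ge 0$ let $\mathcal{H}^s(\Omega)=\{\varphi\in H : \|\varphi\|_s^2=\int_0^\infty(1+\lambda^2)^s\,d\langle E_\lambda\varphi,\varphi\rangle<\infty\}$ with the norm $\|\cdot\|_s$, and for $s>0$ let $\mathcal{H}^{-s}(\Omega)=(\mathcal{H}^s(\Omega))'$ with the dual norm (for complex scalars the space of bounded conjugate-linear functionals, so that $h\in H$ is identified with $x\mapsto\langle x,h\rangle$, where $\langle\cdot,\cdot\rangle$ is conjugate-linear in its first argument). Functions of $A$ act on $\mathcal{H}^{-1/2}(\Omega)$ by duality, and $A$ also denotes its extension $\mathcal{H}^{1/2}(\Omega)\to\mathcal{H}^{-1/2}(\Omega)$. Let $T>0$. Let $V_e$ be the space of all $u\in L^2(0,T;\mathcal{H}^1(\Omega))$ with $(\partial_t^2-A^2)u=0$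 in $(0,T)\times\Omega$ in the sense of distributions. The values $u(0),u(T)\in\mathcal{H}^{1/2}(\Omega)$ and $\partial_tu(0),\partial_tu(T)\in\mathcal{H}^{-1/2}(\Omega)$ are those of the representatives of $u$ in $C([0,T];\mathcal{H}^{1/2}(\Omega))$ and of $\partial_tu$ in $C([0,T];\mathcal{H}^{-1/2}(\Omega))$. For data $(f,g)\in\mathcal{H}^{1/2}(\Omega)\times\mathcal{H}^{-1/2}(\Omega)$, the elliptic Cauchy problem is $$(P_e)\qquad (\partial_t^2-A^2)u=0 \ \text{ in } (0,T)\times\Omega,\qquad u(0)=f,\qquad \partial_tu(0)=g,$$ and it is called consistent if it has a solution $u\in V_e$. Define the affine operator $$T_e:\mathcal{H}^{-1/2}(\Omega)\to\mathcal{H}^{-1/2}(\Omega),\qquad T_e(\varphi)=\tanh(AT)^2\varphi+\sinh(AT)\cosh(AT)^{-2}Af+\cosh(AT)^{-1}g .$$ **Theorem.** Suppose that $(P_e)$ is consistent for the data $(f,g)$. Then its solution $u\in V_e$ is unique, $\partial_tu(T)$ exists as a uniquely determined element of $\mathcal{H}^{-1/2}(\Omega)$, and for every initial guess $\varphi_0\in\mathcal{H}^{-1/2}(\Omega)$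 the iterates $\varphi_k=T_e^k(\varphi_0)$ converge to $\partial_tu(T)$ in the norm of $\mathcal{H}^{-1/2}(\Omega)$ as $k\to\infty$. Moreover, every sequence $(\varphi_k)_{k\ge 0}$ in $\mathcal{H}^{-1/2}(\Omega)$ for which, for each $k\ge 0$, there are $v,w\in V_e$ with $$v(0)=f,\quad \partial_tv(T)=\varphi_k,\qquad \partial_tw(0)=g,\quad w(T)=v(T),\qquad \varphi_{k+1}=\partial_tw(T),$$ satisfies $\varphi_k=T_e^k(\varphi_0)$ for all $k$. -/

import Mathlib

open MeasureTheory Filter Topology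
open scoped InnerProductSpace ContDiff ENNReal

noncomputable section

namespace CauchyElliptic

section Operators

variable {𝕜 : Type*} [RCLike 𝕜] {H : Type*} [NormedAddCommGroup H] [InnerProductSpace 𝕜 H]

/-- The spectrum of an unbounded operator `A`: all `z` for which `A - z : dom A → H` is not
bijective. (For a closed operator, in particular for a self-adjoint one, the inverse of a
bijective `A - z` is automatically bounded.) -/
def pmapSpectrum (A : H →ₗ.[𝕜] H) : Set 𝕜 :=
  {z | ¬ Function.Bijective fun x : A.domain => A x - z • (x : H)}

/-- The eigenspace `ker (A - z)`, as a subspace of `H`. -/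
def pmapEigenspace (A : H →ₗ.[𝕜] H) (z : 𝕜) : Submodule 𝕜 H :=
  (LinearMap.ker (A.toFun - z • A.domain.subtype)).map A.domain.subtype

/-- The spectrum is discrete: it consists of isolated eigenvalues of finite multiplicity. -/
def HasDiscreteSpectrum (A : H →ₗ.[𝕜] H) : Prop :=
  ∀ z ∈ pmapSpectrum A,
    (∃ ε > 0, ∀ w ∈ pmapSpectrum A, w ≠ z → ε ≤ ‖w - z‖) ∧
      pmapEigenspace A z ≠ ⊥ ∧ FiniteDimensional 𝕜 (pmapEigenspace A z)

end Operators

/-- A densely defined, positive, self-adjoint (in general unbounded) operator with discrete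
spectrum on a Hilbert space `H`. Positivity means `⟨A φ, φ⟩ ≥ 0` on the domain. -/
structure PosOp (𝕜 : Type*) [RCLike 𝕜] (H : Type*) [NormedAddCommGroup H]
    [InnerProductSpace 𝕜 H] [CompleteSpace H] where
  /-- the operator -/
  op : H →ₗ.[𝕜] H
  dense_domain : Dense (op.domain : Set H)
  selfAdjoint : IsSelfAdjoint op
  nonneg : ∀ x : op.domain, 0 ≤ RCLike.re ⟪op x, (x : H)⟫_𝕜
  discrete : HasDiscreteSpectrum op

namespace PosOp

variable {𝕜 : Type*} [RCLike 𝕜] {H : Type*} [NormedAddCommGroup H] [InnerProductSpace 𝕜 H]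
  [CompleteSpace H] (A : PosOp 𝕜 H)

/-- The eigenspace of `A` for the real number `μ`; it is `⊥` unless `μ` is an eigenvalue. -/
def eigenspace (μ : ℝ) : Submodule 𝕜 H := pmapEigenspace A.op (μ : 𝕜)

lemma mem_eigenspace {μ : ℝ} {x : H} :
    x ∈ A.eigenspace μ ↔ ∃ h : x ∈ A.op.domain, A.op ⟨x, h⟩ = (μ : 𝕜) • x := by
  simp only [eigenspace, pmapEigenspace, Submodule.mem_map, LinearMap.mem_ker,
    LinearMap.sub_apply, sub_eq_zero]
  constructor
  · rintro ⟨y, hy, rfl⟩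
    exact ⟨y.2, hy⟩
  · rintro ⟨h, hx⟩
    exact ⟨⟨x, h⟩, hx, rfl⟩

instance (μ : ℝ) : FiniteDimensional 𝕜 (A.eigenspace μ) := by
  by_cases hμ : (μ : 𝕜) ∈ pmapSpectrum A.op
  · exact (A.discrete _ hμ).2.2
  · have hbot : A.eigenspace μ = ⊥ := by
      rw [eq_bot_iff]
      intro x hx
      obtain ⟨h, hx⟩ := A.mem_eigenspace.1 hx
      have hinj := (not_not.1 hμ).1
      have : (⟨x, h⟩ : A.op.domain) = 0 := hinj (by simp [hx])
      simpa using congrArg Subtype.val this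
    rw [hbot]
    infer_instance

/-- The orthogonal projection of `H` onto the eigenspace for `μ`. The resolution of the identity
of `A` is `E_lam = ∑_{μ ≤ lam} A.proj μ`, so that `d⟨E_lam φ, φ⟩` is the discrete measure with
mass `‖A.proj μ φ‖ ^ 2` at the point `μ`. -/
def proj (μ : ℝ) : H →L[𝕜] H := (A.eigenspace μ).starProjection

lemma proj_mem (μ : ℝ) (x : H) : A.proj μ x ∈ A.eigenspace μ :=
  Submodule.starProjection_apply_mem _ _

lemma isOrtho_eigenspace {μ ν : ℝ} (h : μ ≠ ν) : A.eigenspace μ ⟂ A.eigenspace ν := by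
  rw [Submodule.isOrtho_iff_inner_eq]
  intro x hx y hy
  obtain ⟨hx, hx'⟩ := A.mem_eigenspace.1 hx
  obtain ⟨hy, hy'⟩ := A.mem_eigenspace.1 hy
  have hs : A.op.IsFormalAdjoint A.op := by
    have h1 := LinearPMap.adjoint_isFormalAdjoint (T := A.op) A.dense_domain
    rwa [(LinearPMap.isSelfAdjoint_def).1 A.selfAdjoint] at h1
  have h2 := hs ⟨x, hx⟩ ⟨y, hy⟩
  rw [hx', hy', inner_smul_left, inner_smul_right, RCLike.conj_ofReal] at h2
  have h3 : ((μ : 𝕜) - (ν : 𝕜)) * ⟪x, y⟫_𝕜 = 0 := by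
    rw [sub_mul, sub_eq_zero]; exact h2
  rcases mul_eq_zero.1 h3 with h4 | h4
  · exact absurd (by exact_mod_cast sub_eq_zero.1 h4) h
  · exact h4

lemma proj_apply_of_mem {μ : ℝ} {x : H} (hx : x ∈ A.eigenspace μ) : A.proj μ x = x :=
  Submodule.starProjection_eq_self_iff.2 hx

lemma proj_apply_of_mem_ne {μ ν : ℝ} (h : μ ≠ ν) {x : H} (hx : x ∈ A.eigenspace ν) :
    A.proj μ x = 0 :=
  (Submodule.starProjection_apply_eq_zero_iff _).2 ((A.isOrtho_eigenspace h).ge hx)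

lemma orthogonalFamily :
    OrthogonalFamily 𝕜 (fun μ : ℝ => A.eigenspace μ) fun μ => (A.eigenspace μ).subtypeₗᵢ := by
  intro μ ν h v w
  exact (Submodule.isOrtho_iff_inner_eq.1 (A.isOrtho_eigenspace h)) _ v.2 _ w.2

lemma summable_norm_sq_proj (x : H) : Summable fun μ : ℝ => ‖A.proj μ x‖ ^ 2 := by
  refine summable_of_sum_le (c := ‖x‖ ^ 2) (fun _ => by positivity) fun s => ?_
  have h1 : ‖∑ μ ∈ s, A.proj μ x‖ ^ 2 = ∑ μ ∈ s, ‖A.proj μ x‖ ^ 2 :=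
    A.orthogonalFamily.norm_sum (fun μ => ⟨A.proj μ x, A.proj_mem μ x⟩) s
  have h3 : ∀ μ, RCLike.re ⟪A.proj μ x, x⟫_𝕜 = ‖A.proj μ x‖ ^ 2 := fun μ => by
    have h := Submodule.inner_starProjection_left_eq_right (A.eigenspace μ) x (A.proj μ x)
    have h' : ⟪A.proj μ x, x⟫_𝕜 = ⟪A.proj μ x, A.proj μ x⟫_𝕜 := by
      rw [← inner_conj_symm, ← inner_conj_symm (A.proj μ x) (A.proj μ x)]
      congr 1
      have h4 : (A.eigenspace μ).starProjection (A.proj μ x) = A.proj μ x :=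
        A.proj_apply_of_mem (A.proj_mem μ x)
      rw [h4] at h
      exact h.symm
    rw [h']
    exact inner_self_eq_norm_sq _
  have h2 : RCLike.re ⟪∑ μ ∈ s, A.proj μ x, x⟫_𝕜 = ∑ μ ∈ s, ‖A.proj μ x‖ ^ 2 := by
    rw [sum_inner, map_sum]
    exact Finset.sum_congr rfl fun μ _ => h3 μ
  have h4 := re_inner_le_norm (𝕜 := 𝕜) (∑ μ ∈ s, A.proj μ x) x
  rw [h2, ← h1] at h4
  rw [← h1]
  nlinarith [norm_nonneg (∑ μ ∈ s, A.proj μ x), norm_nonneg x,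
    sq_nonneg (‖∑ μ ∈ s, A.proj μ x‖ - ‖x‖)]

/-- `(1 + A²)^{s/2} φ` in spectral coordinates. -/
def coords (s : ℝ) (φ : H) : ℝ → H := fun μ => (((1 + μ ^ 2) ^ (s / 2) : ℝ) : 𝕜) • A.proj μ φ

lemma coords_add (s : ℝ) (φ ψ : H) : A.coords s (φ + ψ) = A.coords s φ + A.coords s ψ := by
  funext μ; simp [coords]

lemma coords_smul (s : ℝ) (c : 𝕜) (φ : H) : A.coords s (c • φ) = c • A.coords s φ := by
  funext μ; simp [coords, smul_comm c]

lemma norm_coords_sq (s : ℝ) (φ : H) (μ : ℝ) :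
    ‖A.coords s φ μ‖ ^ 2 = (1 + μ ^ 2) ^ s * ‖A.proj μ φ‖ ^ 2 := by
  have h : (0 : ℝ) < 1 + μ ^ 2 := by positivity
  rw [coords, norm_smul, RCLike.norm_ofReal, abs_of_pos (Real.rpow_pos_of_pos h _), mul_pow,
    ← Real.rpow_natCast, ← Real.rpow_mul h.le]
  norm_num

/-- The set of all `φ ∈ H` with `∫ (1 + lam²)^s d⟨E_lam φ, φ⟩ < ∞`. -/
def hsSubmodule (s : ℝ) : Submodule 𝕜 H where
  carrier := {φ | Summable fun μ : ℝ => (1 + μ ^ 2) ^ s * ‖A.proj μ φ‖ ^ 2}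
  zero_mem' := by
    show Summable fun μ : ℝ => (1 + μ ^ 2) ^ s * ‖A.proj μ 0‖ ^ 2
    simp [summable_zero]
  add_mem' := by
    intro φ ψ hφ hψ
    refine Summable.of_nonneg_of_le (fun μ => by positivity) (fun μ => ?_)
      ((hφ.mul_left 2).add (hψ.mul_left 2))
    have h1 : ‖A.proj μ (φ + ψ)‖ ^ 2 ≤ 2 * ‖A.proj μ φ‖ ^ 2 + 2 * ‖A.proj μ ψ‖ ^ 2 := by
      have := norm_add_le (A.proj μ φ) (A.proj μ ψ)
      rw [map_add]
      nlinarith [norm_nonneg (A.proj μ φ + A.proj μ ψ),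
        sq_nonneg (‖A.proj μ φ‖ - ‖A.proj μ ψ‖)]
    have h2 : (0 : ℝ) ≤ (1 + μ ^ 2) ^ s := by positivity
    nlinarith [mul_le_mul_of_nonneg_left h1 h2]
  smul_mem' := by
    intro c φ hφ
    refine (hφ.mul_left (‖c‖ ^ 2)).congr fun μ => ?_
    rw [map_smul, norm_smul]
    ring

lemma memℓp_coords {s : ℝ} {φ : H} (h : φ ∈ A.hsSubmodule s) : Memℓp (A.coords s φ) 2 := by
  rw [memℓp_gen_iff (by norm_num)]
  refine Summable.congr h fun μ => ?_
  rw [← A.norm_coords_sq]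
  norm_num

/-- The space `ℋ^s` for `s ≥ 0`: all `φ ∈ H` with
`‖φ‖_s² = ∫ (1 + lam²)^s d⟨E_lam φ, φ⟩ = ∑_μ (1 + μ²)^s ‖A.proj μ φ‖² < ∞`,
with the norm `‖·‖_s` (and not with the norm of `H`), see
`Hs.norm_sq_eq`. It is a norm and not only a seminorm, because the eigenvectors of a self-adjoint
operator with discrete spectrum span a dense subspace; the definitions do not use this. -/
def Hs (s : ℝ) : Type _ := A.hsSubmodule s

namespace Hs

variable {A} {s : ℝ}

instance : AddCommGroup (A.Hs s) := inferInstanceAs (AddCommGroup (A.hsSubmodule s))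

instance : Module 𝕜 (A.Hs s) := inferInstanceAs (Module 𝕜 (A.hsSubmodule s))

/-- The inclusion of `ℋ^s` into `H`. -/
def val : A.Hs s →ₗ[𝕜] H := (A.hsSubmodule s).subtype

lemma val_mem (φ : A.Hs s) : φ.val ∈ A.hsSubmodule s := φ.2

/-- The spectral coordinates of `(1 + A²)^{s/2} φ` for `φ ∈ ℋ^s`, as an element of `ℓ²`. -/
def toLp : A.Hs s →ₗ[𝕜] lp (fun _ : ℝ => H) 2 where
  toFun φ := ⟨A.coords s φ.val, A.memℓp_coords φ.val_mem⟩
  map_add' φ ψ := by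
    ext1; exact (congrArg _ (map_add val φ ψ)).trans (A.coords_add s _ _)
  map_smul' c φ := by
    ext1; exact (congrArg _ (map_smul val c φ)).trans (A.coords_smul s c _)

instance : SeminormedAddCommGroup (A.Hs s) := SeminormedAddCommGroup.induced _ _ (toLp (A := A))

instance : NormedSpace 𝕜 (A.Hs s) := NormedSpace.induced 𝕜 _ _ (toLp (A := A))

lemma norm_eq (φ : A.Hs s) : ‖φ‖ = ‖toLp φ‖ := rfl

lemma norm_sq_eq (φ : A.Hs s) :
    ‖φ‖ ^ 2 = ∑' μ : ℝ, (1 + μ ^ 2) ^ s * ‖A.proj μ φ.val‖ ^ 2 := by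
  rw [norm_eq]
  have h := lp.norm_rpow_eq_tsum (p := 2) (by norm_num) (toLp φ)
  simp only [ENNReal.toReal_ofNat, Real.rpow_ofNat] at h
  rw [h]
  exact tsum_congr fun μ => A.norm_coords_sq s φ.val μ

end Hs

/-- `m(A) φ = ∫ m(lam) dE_lam φ` for a bounded function `m` and `φ ∈ H`. -/
def funCalc (m : ℝ → ℝ) (φ : H) : H := ∑' μ : ℝ, (m μ : 𝕜) • A.proj μ φ

lemma summable_funCalc {m : ℝ → ℝ} (hm : ∀ μ, |m μ| ≤ 1) (φ : H) :
    Summable fun μ : ℝ => (m μ : 𝕜) • A.proj μ φ := by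
  have key : Summable fun μ : ℝ => ‖(m μ : 𝕜) • A.proj μ φ‖ ^ 2 := by
    refine Summable.of_nonneg_of_le (fun μ => by positivity) (fun μ => ?_)
      (A.summable_norm_sq_proj φ)
    rw [norm_smul, RCLike.norm_ofReal, mul_pow]
    have h1 : |m μ| ^ 2 ≤ 1 := pow_le_one₀ (abs_nonneg _) (hm μ)
    exact mul_le_of_le_one_left (by positivity) h1
  let v : ∀ μ : ℝ, A.eigenspace μ := fun μ =>
    ⟨(m μ : 𝕜) • A.proj μ φ, (A.eigenspace μ).smul_mem _ (A.proj_mem μ φ)⟩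
  have h2 := (A.orthogonalFamily.summable_iff_norm_sq_summable v).2 key
  exact h2

lemma proj_funCalc {m : ℝ → ℝ} (hm : ∀ μ, |m μ| ≤ 1) (φ : H) (ν : ℝ) :
    A.proj ν (A.funCalc m φ) = (m ν : 𝕜) • A.proj ν φ := by
  rw [funCalc, (A.proj ν).map_tsum (A.summable_funCalc hm φ), tsum_eq_single ν]
  · rw [map_smul, A.proj_apply_of_mem (A.proj_mem ν φ)]
  · intro μ hμ
    rw [map_smul, A.proj_apply_of_mem_ne hμ.symm (A.proj_mem μ φ), smul_zero]

lemma term_funCalc_le {m : ℝ → ℝ} (hm : ∀ μ, |m μ| ≤ 1) (s : ℝ) (φ : H) (μ : ℝ) :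
    (1 + μ ^ 2) ^ s * ‖A.proj μ (A.funCalc m φ)‖ ^ 2 ≤ (1 + μ ^ 2) ^ s * ‖A.proj μ φ‖ ^ 2 := by
  rw [A.proj_funCalc hm, norm_smul, RCLike.norm_ofReal, mul_pow]
  have h1 : |m μ| ^ 2 ≤ 1 := pow_le_one₀ (abs_nonneg _) (hm μ)
  have h2 : |m μ| ^ 2 * ‖A.proj μ φ‖ ^ 2 ≤ ‖A.proj μ φ‖ ^ 2 :=
    mul_le_of_le_one_left (by positivity) h1
  gcongr

lemma funCalc_mem {m : ℝ → ℝ} (hm : ∀ μ, |m μ| ≤ 1) {s : ℝ} {φ : H}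
    (hφ : φ ∈ A.hsSubmodule s) : A.funCalc m φ ∈ A.hsSubmodule s :=
  Summable.of_nonneg_of_le (fun μ => by positivity) (A.term_funCalc_le hm s φ) hφ

/-- `m(A)` as a bounded operator on `ℋ^s`, `s ≥ 0`, for `|m| ≤ 1`. -/
def hsCalc (s : ℝ) (m : ℝ → ℝ) (hm : ∀ μ, |m μ| ≤ 1) : A.Hs s →L[𝕜] A.Hs s :=
  LinearMap.mkContinuous
    { toFun := fun φ => ⟨A.funCalc m φ.val, A.funCalc_mem hm φ.val_mem⟩
      map_add' := fun φ ψ => by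
        refine Subtype.ext ?_
        show A.funCalc m (Hs.val (φ + ψ)) = A.funCalc m φ.val + A.funCalc m ψ.val
        rw [map_add, funCalc, funCalc, funCalc,
          ← (A.summable_funCalc hm _).tsum_add (A.summable_funCalc hm _)]
        simp only [map_add, smul_add]
      map_smul' := fun c φ => by
        refine Subtype.ext ?_
        show A.funCalc m (Hs.val (c • φ)) = c • A.funCalc m φ.val
        rw [map_smul, funCalc, funCalc, ← (A.summable_funCalc hm _).tsum_const_smul c]
        simp only [map_smul, smul_comm c] }
    1 (fun φ => by
      rw [one_mul]
      refine le_of_sq_le_sq ?_ (norm_nonneg _)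
      rw [Hs.norm_sq_eq, Hs.norm_sq_eq]
      exact Summable.tsum_le_tsum (A.term_funCalc_le hm s φ.val)
        (A.funCalc_mem hm φ.val_mem) φ.val_mem)

/-- The space `ℋ^{-s}` for `s > 0`: the dual `(ℋ^s)'` with its dual norm, realised by the bounded
conjugate-linear functionals (over `ℝ`: the bounded linear functionals), so that `h ∈ H` is
identified with `x ↦ ⟨x, h⟩`, linearly in `h`. -/
abbrev HsNeg (s : ℝ) : Type _ := A.Hs s →L⋆[𝕜] 𝕜

/-- `m(A)` on `ℋ^{-s}`, for a real function `m` with `|m| ≤ 1`: `(m(A) φ) x = φ (m(A) x)`. -/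
def negCalc (s : ℝ) (m : ℝ → ℝ) (hm : ∀ μ, |m μ| ≤ 1) (φ : A.HsNeg s) : A.HsNeg s :=
  φ.comp (A.hsCalc s m hm)

lemma norm_bilin_le (x f : A.Hs (1 / 2)) (μ : ℝ) :
    ‖(μ : 𝕜) * ⟪A.proj μ x.val, A.proj μ f.val⟫_𝕜‖ ≤ ‖Hs.toLp x μ‖ * ‖Hs.toLp f μ‖ := by
  have h : (0 : ℝ) < 1 + μ ^ 2 := by positivity
  have h0 : |μ| ≤ (1 + μ ^ 2) ^ ((1 : ℝ) / 2) := by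
    rw [← Real.sqrt_eq_rpow, ← Real.sqrt_sq_eq_abs]
    exact Real.sqrt_le_sqrt (by linarith)
  have h1 : ∀ y : A.Hs (1 / 2),
      ‖Hs.toLp y μ‖ = (1 + μ ^ 2) ^ ((1 : ℝ) / 2 / 2) * ‖A.proj μ y.val‖ := fun y => by
    show ‖A.coords (1 / 2) y.val μ‖ = _
    rw [coords, norm_smul, RCLike.norm_ofReal, abs_of_pos (Real.rpow_pos_of_pos h _)]
  rw [h1, h1, norm_mul, RCLike.norm_ofReal]
  calc |μ| * ‖⟪A.proj μ x.val, A.proj μ f.val⟫_𝕜‖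
      ≤ (1 + μ ^ 2) ^ ((1 : ℝ) / 2) * (‖A.proj μ x.val‖ * ‖A.proj μ f.val‖) := by
        gcongr
        exact norm_inner_le_norm _ _
    _ = _ := by
        have h2 : (1 + μ ^ 2) ^ ((1 : ℝ) / 2)
            = (1 + μ ^ 2) ^ ((1 : ℝ) / 2 / 2) * (1 + μ ^ 2) ^ ((1 : ℝ) / 2 / 2) := by
          rw [← Real.rpow_add h]
          congr 1
          norm_num
        rw [h2]
        ring

lemma bilin_bound (x f : A.Hs (1 / 2)) :
    (Summable fun μ : ℝ => (μ : 𝕜) * ⟪A.proj μ x.val, A.proj μ f.val⟫_𝕜) ∧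
      ‖∑' μ : ℝ, (μ : 𝕜) * ⟪A.proj μ x.val, A.proj μ f.val⟫_𝕜‖ ≤ ‖f‖ * ‖x‖ := by
  obtain ⟨hs, hle⟩ := lp.tsum_mul_le_mul_norm (p := 2) (q := 2)
    (by constructor <;> norm_num) (Hs.toLp x) (Hs.toLp f)
  have hs' := Summable.of_nonneg_of_le (fun _ => norm_nonneg _) (A.norm_bilin_le x f) hs
  refine ⟨hs'.of_norm, ?_⟩
  calc _ ≤ ∑' μ : ℝ, ‖(μ : 𝕜) * ⟪A.proj μ x.val, A.proj μ f.val⟫_𝕜‖ := norm_tsum_le_tsum_norm hs'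
    _ ≤ ∑' μ : ℝ, ‖Hs.toLp x μ‖ * ‖Hs.toLp f μ‖ :=
        Summable.tsum_le_tsum (A.norm_bilin_le x f) hs' hs
    _ ≤ ‖Hs.toLp x‖ * ‖Hs.toLp f‖ := hle
    _ = ‖f‖ * ‖x‖ := by rw [Hs.norm_eq, Hs.norm_eq, mul_comm]

/-- The operator `A`, extended to `A : ℋ^{1/2} → ℋ^{-1/2}`:
`(A f) x = ∫ lam d⟨x, E_lam f⟩ = ∑_μ μ ⟨P_μ x, P_μ f⟩`. -/
def ext (f : A.Hs (1 / 2)) : A.HsNeg (1 / 2) :=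
  LinearMap.mkContinuous
    { toFun := fun x => ∑' μ : ℝ, (μ : 𝕜) * ⟪A.proj μ x.val, A.proj μ f.val⟫_𝕜
      map_add' := fun x y => by
        rw [← (A.bilin_bound x f).1.tsum_add (A.bilin_bound y f).1]
        simp only [map_add, inner_add_left, mul_add]
      map_smul' := fun c x => by
        rw [smul_eq_mul, ← tsum_mul_left]
        simp only [map_smul, inner_smul_left, mul_left_comm] }
    ‖f‖ (fun x => (A.bilin_bound x f).2)

/-! ### The elliptic Cauchy problem -/

/-- Scalar test functions on the open interval `(0, T)`. -/
def IsTest (T : ℝ) (η : ℝ → ℝ) : Prop :=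
  ContDiff ℝ ∞ η ∧ HasCompactSupport η ∧ tsupport η ⊆ Set.Ioo 0 T

/-- `u ∈ V_e`: `u ∈ L²(0, T; ℋ¹)` and `(∂_t² - A²) u = 0` on `(0, T)` in the sense of
distributions, that is, tested with `η(t) x`, `η ∈ C_c^∞(0, T)` and `x` in the domain of `A²`. -/
def MemVe (T : ℝ) (u : ℝ → A.Hs 1) : Prop :=
  MemLp u 2 (volume.restrict (Set.Ioo 0 T)) ∧
    ∀ η : ℝ → ℝ, IsTest T η → ∀ (x : A.op.domain) (hx : A.op x ∈ A.op.domain),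
      ∫ t in Set.Ioo 0 T, (((iteratedDeriv 2 η t : ℝ) : 𝕜) * ⟪(x : H), (u t).val⟫_𝕜
        - ((η t : ℝ) : 𝕜) * ⟪A.op ⟨A.op x, hx⟩, (u t).val⟫_𝕜) = 0

/-- `u(t₀) = f` in `ℋ^{1/2}`, for `t₀ ∈ [0, T]`: the continuous `ℋ^{1/2}`-valued representative
of `u` on `[0, T]` has the value `f` at `t₀`. -/
def HasTrace (T : ℝ) (u : ℝ → A.Hs 1) (t₀ : ℝ) (f : A.Hs (1 / 2)) : Prop :=
  ∃ U : ℝ → A.Hs (1 / 2), ContinuousOn U (Set.Icc 0 T) ∧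
    (∀ᵐ t ∂(volume.restrict (Set.Ioo 0 T)), (U t).val = (u t).val) ∧ U t₀ = f

/-- `∂_t u(t₀) = g` in `ℋ^{-1/2}`, for `t₀ ∈ [0, T]`: the distributional derivative of `u` on
`(0, T)` is represented by a continuous `ℋ^{-1/2}`-valued function on `[0, T]` with the value `g`
at `t₀`. -/
def HasDerivTrace (T : ℝ) (u : ℝ → A.Hs 1) (t₀ : ℝ) (g : A.HsNeg (1 / 2)) : Prop :=
  ∃ W : ℝ → A.HsNeg (1 / 2), ContinuousOn W (Set.Icc 0 T) ∧
    (∀ η : ℝ → ℝ, IsTest T η → ∀ x : A.Hs (1 / 2),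
      ∫ t in Set.Ioo 0 T, ((deriv η t : ℝ) : 𝕜) * ⟪x.val, (u t).val⟫_𝕜
        = -∫ t in Set.Ioo 0 T, ((η t : ℝ) : 𝕜) * W t x) ∧ W t₀ = g

/-- `u` is a solution in `V_e` of the elliptic Cauchy problem with data `(f, g)`:
`(∂_t² - A²) u = 0` in `(0, T)`, `u(0) = f`, `∂_t u(0) = g`. -/
def SolvesCauchy (T : ℝ) (f : A.Hs (1 / 2)) (g : A.HsNeg (1 / 2)) (u : ℝ → A.Hs 1) : Prop :=
  A.MemVe T u ∧ A.HasTrace T u 0 f ∧ A.HasDerivTrace T u 0 g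

/-- The elliptic Cauchy problem is consistent for the data `(f, g)`. -/
def IsConsistent (T : ℝ) (f : A.Hs (1 / 2)) (g : A.HsNeg (1 / 2)) : Prop :=
  ∃ u, A.SolvesCauchy T f g u

/-! ### The iteration -/

lemma abs_tanh_sq_le (T μ : ℝ) : |Real.tanh (μ * T) ^ 2| ≤ 1 := by
  rw [abs_of_nonneg (sq_nonneg _)]
  exact (Real.tanh_sq_lt_one _).le

lemma abs_sinh_div_le (T μ : ℝ) : |Real.sinh (μ * T) / Real.cosh (μ * T) ^ 2| ≤ 1 := by
  rw [abs_div, abs_of_nonneg (sq_nonneg (Real.cosh _)), div_le_one (by positivity)]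
  refine abs_le_of_sq_le_sq ?_ (by positivity)
  nlinarith [Real.cosh_sq (μ * T), sq_nonneg (Real.sinh (μ * T)),
    sq_nonneg (Real.sinh (μ * T) ^ 2)]

lemma abs_inv_cosh_le (T μ : ℝ) : |(Real.cosh (μ * T))⁻¹| ≤ 1 := by
  rw [abs_of_pos (inv_pos.2 (Real.cosh_pos _))]
  exact inv_le_one_of_one_le₀ (Real.one_le_cosh _)

/-- `h_{f,g} = sinh(AT) cosh(AT)⁻² A f + cosh(AT)⁻¹ g`. -/
def affinePart (T : ℝ) (f : A.Hs (1 / 2)) (g : A.HsNeg (1 / 2)) : A.HsNeg (1 / 2) :=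
  A.negCalc (1 / 2) (fun μ => Real.sinh (μ * T) / Real.cosh (μ * T) ^ 2) (abs_sinh_div_le T)
      (A.ext f)
    + A.negCalc (1 / 2) (fun μ => (Real.cosh (μ * T))⁻¹) (abs_inv_cosh_le T) g

/-- The affine operator `T_e φ = tanh(AT)² φ + h_{f,g}` on `ℋ^{-1/2}`. -/
def Te (T : ℝ) (f : A.Hs (1 / 2)) (g φ : A.HsNeg (1 / 2)) : A.HsNeg (1 / 2) :=
  A.negCalc (1 / 2) (fun μ => Real.tanh (μ * T) ^ 2) (abs_tanh_sq_le T) φ + A.affinePart T f g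

/-- One step `φ ↦ φ₁` of the iterative procedure through two mixed boundary value problems in
`V_e`: `v(0) = f`, `∂_t v(T) = φ`, then `∂_t w(0) = g`, `w(T) = v(T)`, and `φ₁ = ∂_t w(T)`. -/
def IsStep (T : ℝ) (f : A.Hs (1 / 2)) (g φ φ₁ : A.HsNeg (1 / 2)) : Prop :=
  ∃ v w : ℝ → A.Hs 1,
    (A.MemVe T v ∧ A.HasTrace T v 0 f ∧ A.HasDerivTrace T v T φ) ∧
    (A.MemVe T w ∧ A.HasDerivTrace T w 0 g ∧ ∃ p, A.HasTrace T v T p ∧ A.HasTrace T w T p) ∧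
    A.HasDerivTrace T w T φ₁

end PosOp

end CauchyElliptic

end

/-! Pair a solution with an eigenvector `e` of eigenvalue `μ`. The coefficient `y(t) = ⟨e, u(t)⟩` is
a classical solution of `y'' = μ² y` on `[0, T]`, so `cosh(μt) y' - sinh(μt) μy` and `cosh(μt) μy -
sinh(μt) y'` are constant in `t` (`IsRep.deriv_zero_eq`, `IsRep.value_zero_eq`). Inverting these
relations gives `y'(T) = cosh(μT) y'(0) + sinh(μT) μy(0)` and uniqueness. Eliminating the common
value `w(T) = v(T)` from them shows that one step of the procedure is `T_e` (`IsStep.eq_Te`).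

In each coordinate `y'(T)` is the fixed point of `T_e`, and every application multiplies the error
by `tanh(μT)² < 1`. These factors may come arbitrarily close to 1, so `T_e` need not be a strict
contraction. The errors still tend to zero in norm, by dominated convergence over the coordinates
(`tendsto_negCalc`).

Coordinates suffice because the eigenvectors span a dense subspace (`eigenComplement_eq_bot`). If
their orthogonal complement `N` were nonzero, bounded resolvents on `N` would yield a spectral point
`z` that is an approximate eigenvalue of the part of `A` in `N`. Isolation of `z`, and the absence
of eigenvectors in `N`, contradict this through a quadratic form estimate. On the dual side, Riesz
representation in `ℓ²` (`HsNeg.exists_riesz`) reduces functionals to their values on eigenvectors.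
-/

namespace CauchyElliptic

/-! ### Approximate eigenvalues of bounded symmetric operators -/

section ApproximateEigenvalue

variable {𝕜 : Type*} [RCLike 𝕜] {E : Type*} [NormedAddCommGroup E] [InnerProductSpace 𝕜 E]

/-- For a bounded symmetric operator `C`, one of `‖C‖` and `-‖C‖` is an approximate eigenvalue. -/
lemma exists_approx_eigenvalue (C : E →L[𝕜] E) (hC : (C : E →ₗ[𝕜] E).IsSymmetric) (h0 : C ≠ 0) :
    ∃ s : ℝ, |s| = ‖C‖ ∧ ∀ ε > 0, ∃ x : E, x ≠ 0 ∧ ‖C x - (s : 𝕜) • x‖ ≤ ε * ‖x‖ := by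
  by_contra! hcon
  have hm : 0 < ‖C‖ := norm_pos_iff.2 h0
  set m := ‖C‖ with hmdef
  obtain ⟨a, ha, ha'⟩ := hcon m (abs_of_pos hm)
  obtain ⟨b, hb, hb'⟩ := hcon (-m) (by rw [abs_neg, abs_of_pos hm])
  -- Factor `C² - m² = (C - m)(C + m)`; both factors are bounded below.
  have hlow : ∀ x : E, a * (b * ‖x‖) ≤ ‖C (C x) - ((m ^ 2 : ℝ) : 𝕜) • x‖ := by
    intro x
    rcases eq_or_ne x 0 with rfl | hx
    · simp
    have h1 := (hb' x hx).le
    set y := C x - ((-m : ℝ) : 𝕜) • x with hy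
    have h2 : C y - (m : 𝕜) • y = C (C x) - ((m ^ 2 : ℝ) : 𝕜) • x := by
      rw [hy, map_sub, map_smul]
      push_cast
      module
    have hy0 : y ≠ 0 := by
      rw [← norm_pos_iff]
      exact lt_of_lt_of_le (by positivity) h1
    rw [← h2]
    exact (mul_le_mul_of_nonneg_left h1 ha.le).trans (ha' y hy0).le
  -- Expand the square and use `‖C²x‖ ≤ m‖Cx‖`. With the lower bound this forces `‖Cx‖²` below
  -- `m²‖x‖²` by a fixed proportion, contradicting `m = ‖C‖`.
  have hup : ∀ x : E, ‖C (C x) - ((m ^ 2 : ℝ) : 𝕜) • x‖ ^ 2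
      ≤ m ^ 2 * (m ^ 2 * ‖x‖ ^ 2 - ‖C x‖ ^ 2) := by
    intro x
    have h3 : RCLike.re ⟪C (C x), ((m ^ 2 : ℝ) : 𝕜) • x⟫_𝕜 = m ^ 2 * ‖C x‖ ^ 2 := by
      rw [inner_smul_right, RCLike.re_ofReal_mul]
      have := hC (C x) x
      simp only [ContinuousLinearMap.coe_coe] at this
      rw [this, inner_self_eq_norm_sq]
    rw [norm_sub_sq (𝕜 := 𝕜), h3, norm_smul, RCLike.norm_ofReal, abs_of_nonneg (sq_nonneg m)]
    have h4 : ‖C (C x)‖ ^ 2 ≤ (m * ‖C x‖) ^ 2 := by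
      gcongr
      exact C.le_opNorm _
    nlinarith
  set κ := (a * b) ^ 2 / m ^ 2 with hκ
  have hκ0 : 0 < κ := by positivity
  have hkey : ∀ x : E, ‖C x‖ ^ 2 ≤ (m ^ 2 - κ) * ‖x‖ ^ 2 := by
    intro x
    have h5 : (a * (b * ‖x‖)) ^ 2 ≤ m ^ 2 * (m ^ 2 * ‖x‖ ^ 2 - ‖C x‖ ^ 2) :=
      (pow_le_pow_left₀ (by positivity) (hlow x) 2).trans (hup x)
    have h6 : (a * (b * ‖x‖)) ^ 2 = m ^ 2 * (κ * ‖x‖ ^ 2) := by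
      rw [hκ]; field_simp
    rw [h6] at h5
    have := le_of_mul_le_mul_left h5 (by positivity)
    linarith
  have h7 : m ≤ Real.sqrt (m ^ 2 - κ) := by
    refine C.opNorm_le_bound (Real.sqrt_nonneg _) fun x => ?_
    rcases eq_or_ne x 0 with rfl | hx
    · simp
    have hx' : 0 < ‖x‖ ^ 2 := by positivity
    have h8 : 0 ≤ m ^ 2 - κ := by
      by_contra! h
      nlinarith [hkey x, sq_nonneg ‖C x‖]
    refine le_of_sq_le_sq ?_ (by positivity)
    rw [mul_pow, Real.sq_sqrt h8]
    exact hkey x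
  have h9 : 0 < m ^ 2 - κ := Real.sqrt_pos.1 (hm.trans_le h7)
  have h10 := pow_le_pow_left₀ hm.le h7 2
  rw [Real.sq_sqrt h9.le] at h10
  linarith

end ApproximateEigenvalue

/-! ### Completeness of the eigenvectors -/

namespace PosOp

variable {𝕜 : Type*} [RCLike 𝕜] {H : Type*} [NormedAddCommGroup H] [InnerProductSpace 𝕜 H]
  [CompleteSpace H] (A : PosOp 𝕜 H)

lemma inner_op_left (x y : A.op.domain) : ⟪A.op x, (y : H)⟫_𝕜 = ⟪(x : H), A.op y⟫_𝕜 := by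
  have h := LinearPMap.adjoint_isFormalAdjoint (T := A.op) A.dense_domain
  rw [(LinearPMap.isSelfAdjoint_def).1 A.selfAdjoint] at h
  exact h x y

/-- The orthogonal complement of the span of all eigenvectors. -/
def eigenComplement : Submodule 𝕜 H := ⨅ μ : ℝ, (A.eigenspace μ)ᗮ

lemma mem_eigenComplement {x : H} :
    x ∈ A.eigenComplement ↔ ∀ μ, ∀ e ∈ A.eigenspace μ, ⟪e, x⟫_𝕜 = 0 := by
  simp only [eigenComplement, Submodule.mem_iInf, Submodule.mem_orthogonal]

instance : CompleteSpace A.eigenComplement := by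
  have h : IsClosed (A.eigenComplement : Set H) := by
    rw [eigenComplement, Submodule.coe_iInf]
    exact isClosed_iInter fun μ => Submodule.isClosed_orthogonal _
  exact h.completeSpace_coe

lemma eq_zero_of_mem_eigenspace_of_mem_eigenComplement {μ : ℝ} {x : H} (h : x ∈ A.eigenspace μ)
    (h' : x ∈ A.eigenComplement) : x = 0 :=
  inner_self_eq_zero.1 (A.mem_eigenComplement.1 h' μ x h)

lemma inner_eigenvector_op_sub {μ c : ℝ} {e : H} (he : e ∈ A.eigenspace μ) (x : A.op.domain) :
    ⟪e, A.op x - (c : 𝕜) • (x : H)⟫_𝕜 = ((μ : 𝕜) - (c : 𝕜)) * ⟪e, (x : H)⟫_𝕜 := by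
  obtain ⟨h, h'⟩ := A.mem_eigenspace.1 he
  rw [inner_sub_right, inner_smul_right, ← A.inner_op_left ⟨e, h⟩ x, h', inner_smul_left,
    RCLike.conj_ofReal]
  ring

lemma op_sub_mem_eigenComplement (c : ℝ) {x : A.op.domain} (hx : (x : H) ∈ A.eigenComplement) :
    A.op x - (c : 𝕜) • (x : H) ∈ A.eigenComplement := by
  refine A.mem_eigenComplement.2 fun μ e he => ?_
  rw [A.inner_eigenvector_op_sub he, A.mem_eigenComplement.1 hx μ e he, mul_zero]

lemma mem_pmapSpectrum_of_mem_eigenspace {μ : ℝ} {x : H} (hx : x ∈ A.eigenspace μ) (h0 : x ≠ 0) :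
    (μ : 𝕜) ∈ pmapSpectrum A.op := by
  obtain ⟨h, h'⟩ := A.mem_eigenspace.1 hx
  intro hb
  have : (⟨x, h⟩ : A.op.domain) = 0 := hb.1 (by simp [h'])
  exact h0 (by simpa using congrArg Subtype.val this)

/-- Discreteness would make `-1` an eigenvalue, which positivity excludes. This supplies a real
point at which a resolvent exists. -/
lemma neg_one_notMem_pmapSpectrum : ((-1 : ℝ) : 𝕜) ∉ pmapSpectrum A.op := by
  intro hz
  have hne : A.eigenspace (-1) ≠ ⊥ := (A.discrete _ hz).2.1
  obtain ⟨x, hx, hx0⟩ := Submodule.exists_mem_ne_zero_of_ne_bot hne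
  obtain ⟨h, h'⟩ := A.mem_eigenspace.1 hx
  have h1 := A.nonneg ⟨x, h⟩
  rw [h', inner_smul_left, RCLike.conj_ofReal, RCLike.re_ofReal_mul, inner_self_eq_norm_sq] at h1
  have : 0 < ‖x‖ ^ 2 := by positivity
  linarith

/-- The resolvent `(A - c)⁻¹`, restricted to the orthogonal complement of the eigenvectors. -/
lemma exists_resolvent {c : ℝ} (hc : (c : 𝕜) ∉ pmapSpectrum A.op) :
    ∃ C : A.eigenComplement →L[𝕜] A.eigenComplement,
      (C : A.eigenComplement →ₗ[𝕜] A.eigenComplement).IsSymmetric ∧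
      (∀ y : A.eigenComplement, ∃ h : (C y : H) ∈ A.op.domain,
        A.op ⟨C y, h⟩ - (c : 𝕜) • (C y : H) = y) ∧
      ∀ x : A.op.domain, ∀ hx : (x : H) ∈ A.eigenComplement,
        (C ⟨_, A.op_sub_mem_eigenComplement c hx⟩ : H) = x := by
  have hb : Function.Bijective (A.op.toFun - (c : 𝕜) • A.op.domain.subtype) := not_not.1 hc
  let L : A.op.domain ≃ₗ[𝕜] H := LinearEquiv.ofBijective _ hb
  have hL : ∀ x : A.op.domain, L x = A.op x - (c : 𝕜) • (x : H) := fun x => rfl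
  let R : H →ₗ[𝕜] H := A.op.domain.subtype ∘ₗ (L.symm : H →ₗ[𝕜] A.op.domain)
  have hR : ∀ y, R y = (L.symm y : H) := fun y => rfl
  have hsol : ∀ y, A.op (L.symm y) - (c : 𝕜) • (L.symm y : H) = y := fun y => by
    rw [← hL, L.apply_symm_apply]
  have hsymm : R.IsSymmetric := by
    intro y z
    rw [hR, hR]
    conv_lhs => rw [← hsol z]
    conv_rhs => rw [← hsol y]
    rw [inner_sub_right, inner_sub_left, A.inner_op_left, inner_smul_left, inner_smul_right,
      RCLike.conj_ofReal]
  have hmaps : ∀ y ∈ A.eigenComplement, R y ∈ A.eigenComplement := by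
    intro y hy
    refine A.mem_eigenComplement.2 fun μ e he => ?_
    rcases eq_or_ne e 0 with rfl | he0
    · simp
    have h1 := A.mem_eigenComplement.1 hy μ e he
    rw [← hsol y, A.inner_eigenvector_op_sub he] at h1
    rcases mul_eq_zero.1 h1 with h2 | h2
    -- Here `μ = c`, so `c` would be an eigenvalue.
    · refine absurd (A.mem_pmapSpectrum_of_mem_eigenspace he he0) ?_
      rwa [sub_eq_zero.1 h2]
    · exact h2
  have hsymm' : (R.restrict hmaps).IsSymmetric := hsymm.restrict_invariant hmaps
  -- Boundedness is the Hellinger–Toeplitz theorem: a symmetric operator defined on all of a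
  -- complete space is continuous.
  refine ⟨⟨R.restrict hmaps, hsymm'.continuous⟩, hsymm', fun y => ⟨(L.symm y).2, hsol y⟩, ?_⟩
  intro x hx
  show (L.symm (A.op x - (c : 𝕜) • (x : H)) : H) = x
  rw [← hL, L.symm_apply_apply]

/-- `z` is an approximate eigenvalue of the part of `A` in the orthogonal complement of the
eigenvectors. -/
def IsApproxEigenvalue (z : ℝ) : Prop :=
  ∀ ε > 0, ∃ x : A.op.domain, (x : H) ∈ A.eigenComplement ∧ (x : H) ≠ 0 ∧
    ‖A.op x - (z : 𝕜) • (x : H)‖ ≤ ε * ‖(x : H)‖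

lemma IsApproxEigenvalue.mem_pmapSpectrum {z : ℝ} (hz : A.IsApproxEigenvalue z) :
    (z : 𝕜) ∈ pmapSpectrum A.op := by
  by_contra hz'
  obtain ⟨C, -, -, hC⟩ := A.exists_resolvent hz'
  obtain ⟨x, hx, hx0, hle⟩ := hz (1 / (2 * (‖C‖ + 1))) (by positivity)
  have h1 : ‖(x : H)‖ ≤ ‖C‖ * ‖A.op x - (z : 𝕜) • (x : H)‖ := by
    conv_lhs => rw [← hC x hx]
    exact C.le_opNorm _
  have hxp : 0 < ‖(x : H)‖ := norm_pos_iff.2 hx0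
  have h2 : ‖C‖ * (1 / (2 * (‖C‖ + 1))) ≤ 1 / 2 := by
    rw [mul_one_div, div_le_div_iff₀ (by positivity) (by norm_num)]
    nlinarith [norm_nonneg C]
  nlinarith [mul_le_mul_of_nonneg_left hle (norm_nonneg C)]

/-- The resolvent `C` at `c` has an approximate eigenvalue `s = ±‖C‖`, and `z = c + s⁻¹` then lies
at distance `‖C‖⁻¹` from `c`. The lower bound is `‖x‖ ≤ ‖C‖ ‖(A - c)x‖` rewritten. -/
lemma exists_isApproxEigenvalue {c : ℝ} (hc : (c : 𝕜) ∉ pmapSpectrum A.op)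
    (hN : A.eigenComplement ≠ ⊥) :
    ∃ z, A.IsApproxEigenvalue z ∧ ∀ x : A.op.domain, (x : H) ∈ A.eigenComplement →
      |z - c| * ‖(x : H)‖ ≤ ‖A.op x - (c : 𝕜) • (x : H)‖ := by
  obtain ⟨C, hsymm, hC, hC'⟩ := A.exists_resolvent hc
  have hC0 : C ≠ 0 := by
    rintro rfl
    obtain ⟨y, hy, hy0⟩ := Submodule.exists_mem_ne_zero_of_ne_bot hN
    obtain ⟨h, h'⟩ := hC ⟨y, hy⟩
    have h1 : (⟨((0 : A.eigenComplement →L[𝕜] A.eigenComplement) ⟨y, hy⟩ : H), h⟩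
      : A.op.domain) = 0 := by ext; simp
    rw [h1] at h'
    simp at h'
    exact hy0 h'.symm
  obtain ⟨s, hs, hs'⟩ := exists_approx_eigenvalue C hsymm hC0
  have hm : 0 < ‖C‖ := norm_pos_iff.2 hC0
  have hs0 : s ≠ 0 := by
    rintro rfl
    rw [abs_zero] at hs
    exact hC0 (norm_eq_zero.1 hs.symm)
  have hs0' : (s : 𝕜) ≠ 0 := by exact_mod_cast hs0
  refine ⟨c + s⁻¹, fun ε hε => ?_, fun x hx => ?_⟩
  -- The approximate eigenvector of `A` is `C x`. The first bound keeps `‖C x‖ ≥ ‖C‖‖x‖/2`; the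
  -- second makes the error at most `ε‖C x‖` after division by `s`.
  · obtain ⟨x, hx0, hx⟩ := hs' (min (‖C‖ / 2) (ε * ‖C‖ ^ 2 / 2)) (by positivity)
    obtain ⟨h, h'⟩ := hC x
    have hxp : 0 < ‖x‖ := norm_pos_iff.2 hx0
    have h1 : ‖C x - (s : 𝕜) • x‖ ≤ ‖C‖ / 2 * ‖x‖ := hx.trans (by gcongr; exact min_le_left _ _)
    have h2 : ‖C x - (s : 𝕜) • x‖ ≤ ε * ‖C‖ ^ 2 / 2 * ‖x‖ :=
      hx.trans (by gcongr; exact min_le_right _ _)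
    have h3 : ‖C‖ / 2 * ‖x‖ ≤ ‖C x‖ := by
      have h4 : ‖(s : 𝕜) • x‖ = ‖C‖ * ‖x‖ := by rw [norm_smul, RCLike.norm_ofReal, hs]
      have h5 := norm_sub_norm_le ((s : 𝕜) • x) (C x)
      rw [norm_sub_rev, h4] at h5
      linarith
    refine ⟨⟨C x, h⟩, (C x).2, ?_, ?_⟩
    · have : 0 < ‖(C x : H)‖ := lt_of_lt_of_le (by positivity) h3
      exact norm_pos_iff.1 this
    · have h6 : A.op ⟨C x, h⟩ - ((c + s⁻¹ : ℝ) : 𝕜) • (C x : H)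
          = -(s : 𝕜)⁻¹ • ((C x : H) - (s : 𝕜) • (x : H)) := by
        rw [sub_eq_iff_eq_add.1 h', smul_sub, smul_smul, neg_mul, inv_mul_cancel₀ hs0']
        push_cast
        module
      have h7 : ‖(C x : H) - (s : 𝕜) • (x : H)‖ ≤ ε * ‖C‖ ^ 2 / 2 * ‖x‖ := h2
      rw [h6, norm_smul, norm_neg, norm_inv, RCLike.norm_ofReal, hs]
      calc ‖C‖⁻¹ * ‖(C x : H) - (s : 𝕜) • (x : H)‖ ≤ ‖C‖⁻¹ * (ε * ‖C‖ ^ 2 / 2 * ‖x‖) := by gcongr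
        _ = ε * (‖C‖ / 2 * ‖x‖) := by field_simp
        _ ≤ ε * ‖(C x : H)‖ := by gcongr; exact h3
  · have h1 : ‖(x : H)‖ ≤ ‖C‖ * ‖A.op x - (c : 𝕜) • (x : H)‖ := by
      conv_lhs => rw [← hC' x hx]
      exact C.le_opNorm _
    rw [add_sub_cancel_left, abs_inv, hs, inv_mul_le_iff₀ hm]
    exact h1

lemma norm_op_sub_sq_shift (x : A.op.domain) (z δ : ℝ) :
    ‖A.op x - ((z + δ : ℝ) : 𝕜) • (x : H)‖ ^ 2 = ‖A.op x - (z : 𝕜) • (x : H)‖ ^ 2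
      - 2 * δ * RCLike.re ⟪A.op x - (z : 𝕜) • (x : H), (x : H)⟫_𝕜 + δ ^ 2 * ‖(x : H)‖ ^ 2 := by
  have h : A.op x - ((z + δ : ℝ) : 𝕜) • (x : H)
      = (A.op x - (z : 𝕜) • (x : H)) - (δ : 𝕜) • (x : H) := by
    push_cast; module
  rw [h, norm_sub_sq (𝕜 := 𝕜), inner_smul_right, RCLike.re_ofReal_mul, norm_smul,
    RCLike.norm_ofReal, mul_pow, sq_abs]
  ring

/-- The eigenvectors of a self-adjoint operator with discrete spectrum span a dense subspace. -/
theorem eigenComplement_eq_bot : A.eigenComplement = ⊥ := by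
  by_contra hN
  obtain ⟨z, hz, -⟩ := A.exists_isApproxEigenvalue A.neg_one_notMem_pmapSpectrum hN
  obtain ⟨ε, hε, hiso⟩ := (A.discrete _ (IsApproxEigenvalue.mem_pmapSpectrum A hz)).1
  obtain ⟨δ, hδ, hδε⟩ : ∃ δ : ℝ, 0 < δ ∧ 2 * δ < ε := ⟨ε / 4, by positivity, by linarith⟩
  have hiso' : ∀ w : ℝ, (w : 𝕜) ∈ pmapSpectrum A.op → w ≠ z → ε ≤ |w - z| := fun w hw hne => by
    have := hiso w hw (by exact_mod_cast hne)
    rwa [← RCLike.ofReal_sub, RCLike.norm_ofReal] at this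
  -- At `z ± δ` the resolvent exists, and its nearest approximate eigenvalue `w` is either `z`, at
  -- distance `δ`, or at distance at least `ε - δ > δ`.
  have hgap : ∀ r : ℝ, |r| = δ → ∀ x : A.op.domain, (x : H) ∈ A.eigenComplement →
      δ * ‖(x : H)‖ ≤ ‖A.op x - ((z + r : ℝ) : 𝕜) • (x : H)‖ := by
    intro r hr x hx
    have hr0 : r ≠ 0 := by rintro rfl; simp at hr; linarith
    have hns : ((z + r : ℝ) : 𝕜) ∉ pmapSpectrum A.op := fun h => by
      have := hiso' _ h (by simpa using hr0)
      rw [add_sub_cancel_left, hr] at this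
      linarith
    obtain ⟨w, hw, hw'⟩ := A.exists_isApproxEigenvalue hns hN
    refine le_trans ?_ (hw' x hx)
    gcongr
    rcases eq_or_ne w z with rfl | hne
    · rw [sub_add_cancel_left, abs_neg, hr]
    · have h1 := hiso' w (IsApproxEigenvalue.mem_pmapSpectrum A hw) hne
      have h2 := abs_sub_abs_le_abs_sub (w - z) r
      rw [← sub_sub]
      linarith
  let B : A.op.domain →ₗ[𝕜] H := A.op.toFun - (z : 𝕜) • A.op.domain.subtype
  have hB : ∀ x : A.op.domain, B x = A.op x - (z : 𝕜) • (x : H) := fun x => rfl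
  have hBsymm : ∀ x y : A.op.domain, ⟪B x, (y : H)⟫_𝕜 = ⟪(x : H), B y⟫_𝕜 := fun x y => by
    rw [hB, hB, inner_sub_left, inner_sub_right, A.inner_op_left, inner_smul_left,
      inner_smul_right, RCLike.conj_ofReal]
  -- Expand `‖(B ∓ δ)x‖² ≥ δ²‖x‖²`: the terms `δ²‖x‖²` cancel, leaving a bound by `‖B x‖²` alone.
  have hquad : ∀ x : A.op.domain, (x : H) ∈ A.eigenComplement →
      |RCLike.re ⟪B x, (x : H)⟫_𝕜| ≤ ‖B x‖ ^ 2 / (2 * δ) := by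
    intro x hx
    have h1 := pow_le_pow_left₀ (by positivity) (hgap δ (abs_of_pos hδ) x hx) 2
    have h2 := pow_le_pow_left₀ (by positivity)
      (hgap (-δ) (by rw [abs_neg, abs_of_pos hδ]) x hx) 2
    rw [A.norm_op_sub_sq_shift, ← hB] at h1 h2
    rw [le_div_iff₀ (by positivity), ← abs_of_pos (show 0 < 2 * δ by positivity), ← abs_mul,
      abs_le]
    constructor <;> nlinarith
  have hpol : ∀ x y : A.op.domain, (x : H) ∈ A.eigenComplement → (y : H) ∈ A.eigenComplement →
      RCLike.re ⟪B x, (y : H)⟫_𝕜 ≤ (‖B x‖ ^ 2 + ‖B y‖ ^ 2) / (4 * δ) := by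
    intro x y hx hy
    have h1 := (abs_le.1 (hquad (x + y) (A.eigenComplement.add_mem hx hy))).2
    have h2 := (abs_le.1 (hquad (x - y) (A.eigenComplement.sub_mem hx hy))).1
    have h3 := parallelogram_law_with_norm 𝕜 (B x) (B y)
    have h4 : RCLike.re ⟪B y, (x : H)⟫_𝕜 = RCLike.re ⟪B x, (y : H)⟫_𝕜 := by
      rw [hBsymm, inner_re_symm]
    simp only [map_add, map_sub, Submodule.coe_add, Submodule.coe_sub, inner_add_left,
      inner_add_right, inner_sub_left, inner_sub_right] at h1 h2
    rw [h4] at h1 h2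
    rw [le_div_iff₀ (by positivity)] at h1 ⊢
    rw [← neg_div, div_le_iff₀ (by positivity)] at h2
    nlinarith
  obtain ⟨C, hCsymm, hC, -⟩ := A.exists_resolvent A.neg_one_notMem_pmapSpectrum
  -- This is `B ∘ C` with `C = (A + 1)⁻¹`. It is symmetric and, as the complement contains no
  -- eigenvectors, injective; so its range is dense, and `B x` in `hpol` may be replaced by any
  -- vector of the complement.
  let K : A.eigenComplement →L[𝕜] A.eigenComplement :=
    ContinuousLinearMap.id 𝕜 _ - ((z + 1 : ℝ) : 𝕜) • C
  have hK : ∀ n, K n = n - ((z + 1 : ℝ) : 𝕜) • C n := fun n => rfl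
  have hKB : ∀ n, ∃ x : A.op.domain, (x : H) ∈ A.eigenComplement ∧ (x : H) = C n ∧
      B x = K n := by
    intro n
    obtain ⟨h, h'⟩ := hC n
    refine ⟨⟨C n, h⟩, (C n).2, rfl, ?_⟩
    rw [hB, hK, sub_eq_iff_eq_add.1 h']
    push_cast
    module
  have hKsymm : ∀ m n, ⟪K m, n⟫_𝕜 = ⟪m, K n⟫_𝕜 := fun m n => by
    have := hCsymm m n
    simp only [ContinuousLinearMap.coe_coe] at this
    rw [hK, hK, inner_sub_left, inner_sub_right, inner_smul_left, inner_smul_right,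
      RCLike.conj_ofReal, this]
  have hKdense : DenseRange K := by
    have h1 : (LinearMap.range (K : A.eigenComplement →ₗ[𝕜] A.eigenComplement))ᗮ = ⊥ := by
      rw [eq_bot_iff]
      intro n hn
      have h2 : K n = 0 := by
        have h2 := (Submodule.mem_orthogonal _ _).1 hn (K (K n)) ⟨K n, rfl⟩
        rw [← inner_self_eq_zero (𝕜 := 𝕜), hKsymm, ← inner_conj_symm, h2, map_zero]
      obtain ⟨x, hx, hxC, hxB⟩ := hKB n
      have h3 : (x : H) = 0 := by
        refine A.eq_zero_of_mem_eigenspace_of_mem_eigenComplement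
          (A.mem_eigenspace.2 ⟨x.2, ?_⟩) hx (μ := z)
        rw [h2, hB] at hxB
        exact sub_eq_zero.1 hxB
      have h4 : C n = 0 := Subtype.ext (by rw [← hxC, h3]; rfl)
      have h5 := hK n
      rw [h2, h4, smul_zero, sub_zero] at h5
      exact h5.symm
    have h6 := (Submodule.topologicalClosure_eq_top_iff).2 h1
    have h7 := (Submodule.dense_iff_topologicalClosure_eq_top).2 h6
    exact h7
  obtain ⟨y, hy, hy0, hyle⟩ := hz δ hδ
  rw [← hB] at hyle
  have hall : ∀ n : A.eigenComplement,
      RCLike.re ⟪(n : H), (y : H)⟫_𝕜 ≤ (‖(n : H)‖ ^ 2 + ‖B y‖ ^ 2) / (4 * δ) := by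
    intro n
    refine hKdense.induction_on n (isClosed_le (by fun_prop) (by fun_prop)) fun n => ?_
    obtain ⟨x, hx, -, hxB⟩ := hKB n
    rw [← hxB]
    exact hpol x y hx hy
  -- With `‖B y‖ ≤ δ‖y‖`, the choice `n = 2δy` gives `2δ‖y‖² ≤ (5/4)δ‖y‖²`, which is absurd.
  have hfin := hall (((2 * δ : ℝ) : 𝕜) • ⟨y, hy⟩)
  have hyp : 0 < ‖(y : H)‖ ^ 2 := by positivity
  have hB2 := pow_le_pow_left₀ (norm_nonneg _) hyle 2
  rw [Submodule.coe_smul, inner_smul_left, RCLike.conj_ofReal, RCLike.re_ofReal_mul,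
    inner_self_eq_norm_sq, norm_smul, RCLike.norm_ofReal, mul_pow, sq_abs,
    le_div_iff₀ (by positivity)] at hfin
  have : 0 < δ ^ 2 * ‖(y : H)‖ ^ 2 := by positivity
  nlinarith

lemma eq_zero_of_inner_eigenvector_eq_zero {x : H}
    (h : ∀ μ, ∀ e ∈ A.eigenspace μ, ⟪e, x⟫_𝕜 = 0) : x = 0 := by
  have := A.mem_eigenComplement.2 h
  rwa [A.eigenComplement_eq_bot, Submodule.mem_bot] at this

end PosOp

/-! ### Test functions and weak derivatives on an interval -/

namespace PosOp

section TestFunctions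

variable {E : Type*} [NormedAddCommGroup E] [NormedSpace ℝ E] {T : ℝ}

lemma IsTest.eq_zero_of_notMem {η : ℝ → ℝ} (h : IsTest T η) {t : ℝ} (ht : t ∉ Set.Ioo 0 T) :
    η t = 0 :=
  image_eq_zero_of_notMem_tsupport fun h' => ht (h.2.2 h')

lemma IsTest.deriv {η : ℝ → ℝ} (h : IsTest T η) : IsTest T (deriv η) :=
  ⟨(contDiff_infty_iff_deriv.1 h.1).2, h.2.1.deriv,
    (closure_minimal support_deriv_subset (isClosed_tsupport _)).trans h.2.2⟩

lemma IsTest.sub_const_mul {η ρ : ℝ → ℝ} (h : IsTest T η) (h' : IsTest T ρ) (c : ℝ) :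
    IsTest T (fun t => η t - c * ρ t) :=
  ⟨h.1.sub (contDiff_const.mul h'.1), h.2.1.sub (h'.2.1.mul_left),
    (tsupport_sub η _).trans (Set.union_subset h.2.2
      ((closure_mono (Function.support_mul_subset_right _ _)).trans h'.2.2))⟩

lemma IsTest.setIntegral_smul {η : ℝ → ℝ} (h : IsTest T η) (G : ℝ → E) :
    ∫ t in Set.Ioo 0 T, η t • G t = ∫ t, η t • G t :=
  setIntegral_eq_integral_of_forall_compl_eq_zero fun t ht => by
    rw [h.eq_zero_of_notMem ht, zero_smul]

lemma IsTest.integrable_smul {η : ℝ → ℝ} (h : IsTest T η) {G : ℝ → E} (hG : Continuous G) :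
    Integrable fun t => η t • G t :=
  (h.1.continuous.smul hG).integrable_of_hasCompactSupport h.2.1.smul_right

/-- A test function with integral zero is the derivative of a test function. -/
lemma IsTest.exists_primitive (hT : 0 < T) {ζ : ℝ → ℝ} (h : IsTest T ζ) (h0 : ∫ t, ζ t = 0) :
    ∃ η, IsTest T η ∧ _root_.deriv η = ζ := by
  -- The point `T / 2` makes the compact set nonempty even when `ζ = 0`.
  have hK : IsCompact (insert (T / 2) (tsupport ζ)) := h.2.1.isCompact.insert _
  have hsub : insert (T / 2) (tsupport ζ) ⊆ Set.Ioo 0 T :=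
    Set.insert_subset ⟨by linarith, by linarith⟩ h.2.2
  obtain ⟨a, ha, ha'⟩ := hK.exists_isLeast (Set.insert_nonempty _ _)
  obtain ⟨b, hb, hb'⟩ := hK.exists_isGreatest (Set.insert_nonempty _ _)
  have ha0 : 0 < a := (hsub ha).1
  have hbT : b < T := (hsub hb).2
  have hζ : ∀ t, t ∉ Set.Icc a b → ζ t = 0 := fun t ht =>
    image_eq_zero_of_notMem_tsupport fun h' => ht ⟨ha' (Or.inr h'), hb' (Or.inr h')⟩
  -- The base point `a / 2` is strictly between `0` and the support of `ζ`.
  have hder : ∀ t, HasDerivAt (fun t => ∫ x in (a / 2)..t, ζ x) (ζ t) t := fun t =>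
    intervalIntegral.integral_hasDerivAt_right (h.1.continuous.intervalIntegrable _ _)
      (h.1.continuous.stronglyMeasurableAtFilter _ _) h.1.continuous.continuousAt
  have hderiv : _root_.deriv (fun t => ∫ x in (a / 2)..t, ζ x) = ζ :=
    funext fun t => (hder t).deriv
  have hsupp : ∀ t, t ∉ Set.Icc (a / 2) b → ∫ x in (a / 2)..t, ζ x = 0 := by
    intro t ht
    by_cases hta : t < a / 2
    · refine intervalIntegral.integral_zero_ae (ae_of_all _ fun x hx => hζ x fun hx' => ?_)
      rw [Set.uIoc_of_ge hta.le] at hx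
      linarith [hx.2, hx'.1]
    · have htb : b < t := by
        by_contra! h'
        exact ht ⟨not_lt.1 hta, h'⟩
      rw [intervalIntegral.integral_eq_integral_of_support_subset, h0]
      intro x hx
      have : x ∈ Set.Icc a b := by
        by_contra h'
        exact hx (hζ x h')
      exact ⟨by linarith [this.1], by linarith [this.2]⟩
  have htsupp : tsupport (fun t => ∫ x in (a / 2)..t, ζ x) ⊆ Set.Icc (a / 2) b :=
    closure_minimal (fun t ht => by_contra fun h' => ht (hsupp t h')) isClosed_Icc
  refine ⟨_, ⟨?_, ?_, ?_⟩, hderiv⟩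
  · refine contDiff_infty_iff_deriv.2 ⟨fun t => (hder t).differentiableAt, ?_⟩
    rw [hderiv]
    exact h.1
  · exact isCompact_Icc.of_isClosed_subset (isClosed_tsupport _) htsupp
  · exact htsupp.trans fun t ht => ⟨by linarith [ht.1], by linarith [ht.2]⟩

lemma exists_isTest_integral_eq_one (hT : 0 < T) : ∃ ρ, IsTest T ρ ∧ ∫ t, ρ t = 1 := by
  let b : ContDiffBump (T / 2) := ⟨T / 8, T / 4, by positivity, by linarith⟩
  refine ⟨b.normed volume, ⟨b.contDiff_normed, b.hasCompactSupport_normed, ?_⟩,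
    b.integral_normed⟩
  rw [b.tsupport_normed_eq, Real.closedBall_eq_Icc]
  intro t ht
  have h1 : T / 2 - T / 4 ≤ t := ht.1
  have h2 : t ≤ T / 2 + T / 4 := ht.2
  exact ⟨by linarith, by linarith⟩

variable [CompleteSpace E]

/-- The fundamental lemma of the calculus of variations gives equality almost everywhere inside;
continuity carries it to all points, end points included. -/
lemma eqOn_Icc_of_integral_isTest (hT : 0 < T) {F G : ℝ → E} (hF : ContinuousOn F (Set.Icc 0 T))
    (hG : ContinuousOn G (Set.Icc 0 T))
    (h : ∀ η, IsTest T η → ∫ t in Set.Ioo 0 T, η t • F t = ∫ t in Set.Ioo 0 T, η t • G t) :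
    Set.EqOn F G (Set.Icc 0 T) := by
  have hint : ∀ {K : ℝ → E}, ContinuousOn K (Set.Icc 0 T) → ∀ {η}, IsTest T η →
      IntegrableOn (fun t => η t • K t) (Set.Ioo 0 T) := fun hK η hη =>
    ((hη.1.continuous.continuousOn.smul hK).integrableOn_Icc).mono_set Set.Ioo_subset_Icc_self
  have h1 := isOpen_Ioo.ae_eq_zero_of_integral_contDiff_smul_eq_zero (μ := volume)
    (f := fun t => F t - G t) (U := Set.Ioo 0 T)
    (((hF.sub hG).mono Set.Ioo_subset_Icc_self).locallyIntegrableOn measurableSet_Ioo)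
    fun η h1 h2 h3 => by
      have hη : IsTest T η := ⟨h1, h2, h3⟩
      rw [← hη.setIntegral_smul]
      simp only [smul_sub]
      rw [integral_sub (hint hF hη) (hint hG hη), h η hη, sub_self]
  refine Measure.eqOn_Icc_of_ae_eq volume hT.ne ?_ hF hG
  rw [← restrict_Ioo_eq_restrict_Icc]
  filter_upwards [(ae_restrict_iff' measurableSet_Ioo).2 h1] with t ht
  exact sub_eq_zero.1 ht

/-- The lemma of du Bois-Reymond. -/
lemma exists_const_of_integral_deriv_isTest (hT : 0 < T) {G : ℝ → E} (hG : Continuous G)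
    (h : ∀ η, IsTest T η → ∫ t in Set.Ioo 0 T, _root_.deriv η t • G t = 0) :
    ∃ c, ∀ t ∈ Set.Icc 0 T, G t = c := by
  obtain ⟨ρ, hρ, hρ1⟩ := exists_isTest_integral_eq_one hT
  refine ⟨∫ t, ρ t • G t, eqOn_Icc_of_integral_isTest hT hG.continuousOn continuousOn_const
    fun ζ hζ => ?_⟩
  have hρi : Integrable ρ := hρ.1.continuous.integrable_of_hasCompactSupport hρ.2.1
  have hζi : Integrable ζ := hζ.1.continuous.integrable_of_hasCompactSupport hζ.2.1
  -- Removing the mean with `ρ` leaves a test function of integral zero, hence a derivative of a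
  -- test function.
  have h1 := hζ.sub_const_mul hρ (∫ t, ζ t)
  obtain ⟨η, hη, hηd⟩ := h1.exists_primitive hT (by
    rw [integral_sub hζi (hρi.const_mul _), integral_const_mul, hρ1, mul_one, sub_self])
  have h2 := h η hη
  rw [hηd, h1.setIntegral_smul] at h2
  simp only [sub_smul, mul_smul] at h2
  rw [integral_sub (hζ.integrable_smul hG)
    (g := fun t => (∫ t, ζ t) • ρ t • G t) ((hρ.integrable_smul hG).smul _), integral_smul,
    sub_eq_zero] at h2
  rw [hζ.setIntegral_smul, hζ.setIntegral_smul, h2, integral_smul_const]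

/-- A continuous weak derivative is a classical one: `Y` minus a primitive of `Z` has weak
derivative zero, so it is constant by du Bois-Reymond. -/
lemma hasDerivWithinAt_of_integral_isTest (hT : 0 < T) {Y Z : ℝ → E}
    (hY : ContinuousOn Y (Set.Icc 0 T)) (hZ : ContinuousOn Z (Set.Icc 0 T))
    (h : ∀ η, IsTest T η →
      ∫ t in Set.Ioo 0 T, _root_.deriv η t • Y t = -∫ t in Set.Ioo 0 T, η t • Z t) :
    ∀ t ∈ Set.Icc 0 T, HasDerivWithinAt Y (Z t) (Set.Icc 0 T) t := by
  -- Extension by the end values makes both functions continuous on the whole line.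
  let Y' : ℝ → E := fun t => Y (Set.projIcc 0 T hT.le t)
  let Z' : ℝ → E := fun t => Z (Set.projIcc 0 T hT.le t)
  have hY' : Continuous Y' := 
    hY.comp_continuous (by fun_prop) fun t => (Set.projIcc 0 T hT.le t).2
  have hZ' : Continuous Z' := 
    hZ.comp_continuous (by fun_prop) fun t => (Set.projIcc 0 T hT.le t).2
  have hYe : ∀ t ∈ Set.Icc 0 T, Y' t = Y t := fun t ht => by
    simp only [Y', Set.projIcc_of_mem hT.le ht]
  have hZe : ∀ t ∈ Set.Icc 0 T, Z' t = Z t := fun t ht => by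
    simp only [Z', Set.projIcc_of_mem hT.le ht]
  let P : ℝ → E := fun t => ∫ x in (0 : ℝ)..t, Z' x
  have hP : ∀ t, HasDerivAt P (Z' t) t := fun t =>
    intervalIntegral.integral_hasDerivAt_right (hZ'.intervalIntegrable _ _)
      (hZ'.stronglyMeasurableAtFilter _ _) hZ'.continuousAt
  have hPc : Continuous P := continuous_iff_continuousAt.2 fun t => (hP t).continuousAt
  obtain ⟨c, hc⟩ := exists_const_of_integral_deriv_isTest hT (hY'.sub hPc) fun η hη => by
    have h1 : ∫ t in Set.Ioo 0 T, _root_.deriv η t • Y' t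
        = -∫ t in Set.Ioo 0 T, η t • Z' t := by
      rw [setIntegral_congr_fun measurableSet_Ioo fun t ht => by
          show _ = _root_.deriv η t • Y t
          rw [hYe t (Set.Ioo_subset_Icc_self ht)], h η hη,
        setIntegral_congr_fun measurableSet_Ioo fun t ht => by
          show _ = η t • Z' t
          rw [hZe t (Set.Ioo_subset_Icc_self ht)]]
    -- The integrand is `(ηP)'`, and `η` vanishes at both end points.
    have h2 : ∫ t in Set.Ioo 0 T, (η t • Z' t + _root_.deriv η t • P t) = 0 := by
      rw [← integral_Ioc_eq_integral_Ioo, ← intervalIntegral.integral_of_le hT.le,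
        intervalIntegral.integral_eq_sub_of_hasDerivAt (f := fun t => η t • P t)
          (fun t _ => ((hη.1.differentiable (by simp) t).hasDerivAt).smul (hP t))
          (((hη.1.continuous.smul hZ').add
            (hη.deriv.1.continuous.smul hPc)).intervalIntegrable _ _),
        hη.eq_zero_of_notMem (t := T) (by simp), hη.eq_zero_of_notMem (t := 0) (by simp)]
      simp
    rw [integral_add (hη.integrable_smul hZ').integrableOn
      (hη.deriv.integrable_smul hPc).integrableOn] at h2
    simp only [Pi.sub_apply, smul_sub]
    rw [integral_sub (hη.deriv.integrable_smul hY').integrableOn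
      (hη.deriv.integrable_smul hPc).integrableOn, h1, ← neg_add', h2,
      neg_zero]
  intro t ht
  have h3 : HasDerivWithinAt (fun t => P t + c) (Z t) (Set.Icc 0 T) t := by
    rw [← hZe t ht]
    exact ((hP t).add_const c).hasDerivWithinAt
  have h4 : ∀ s ∈ Set.Icc 0 T, Y s = P s + c := fun s hs => by
    rw [← hYe s hs, ← hc s hs, Pi.sub_apply, add_sub_cancel]
  exact h3.congr h4 (h4 t ht)

end TestFunctions

section RealVariable

lemma hasDerivAt_cosh_mul (μ t : ℝ) :
    HasDerivAt (fun t => Real.cosh (μ * t)) (Real.sinh (μ * t) * μ) t := by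
  simpa using ((hasDerivAt_id t).const_mul μ).cosh

lemma hasDerivAt_sinh_mul (μ t : ℝ) :
    HasDerivAt (fun t => Real.sinh (μ * t)) (Real.cosh (μ * t) * μ) t := by
  simpa using ((hasDerivAt_id t).const_mul μ).sinh

lemma eq_of_hasDerivWithinAt_zero {E : Type*} [NormedAddCommGroup E] [NormedSpace ℝ E]
    {T : ℝ} {F : ℝ → E}
    (h : ∀ t ∈ Set.Icc 0 T, HasDerivWithinAt F 0 (Set.Icc 0 T) t) :
    ∀ t ∈ Set.Icc 0 T, F t = F 0 :=
  constant_of_has_deriv_right_zero (fun t ht => (h t ht).continuousWithinAt) fun t ht =>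
    (h t ⟨ht.1, ht.2.le⟩).mono_of_mem_nhdsWithin (Icc_mem_nhdsGE_of_mem ht)

end RealVariable

/-! ### Solutions in eigenvector coordinates -/

variable {𝕜 : Type*} [RCLike 𝕜] {H : Type*} [NormedAddCommGroup H] [InnerProductSpace 𝕜 H]
  [CompleteSpace H] (A : PosOp 𝕜 H)

lemma proj_eigenvector_of_ne {μ ν : ℝ} (h : ν ≠ μ) (e : A.eigenspace μ) :
    A.proj ν (e : H) = 0 :=
  A.proj_apply_of_mem_ne h e.2

lemma inner_eigenvector_proj {μ : ℝ} (e : A.eigenspace μ) (x : H) :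
    ⟪(e : H), A.proj μ x⟫_𝕜 = ⟪(e : H), x⟫_𝕜 := by
  have h := Submodule.inner_starProjection_left_eq_right (A.eigenspace μ) (e : H) x
  have h' : (A.eigenspace μ).starProjection (e : H) = e := A.proj_apply_of_mem e.2
  rw [h'] at h
  exact h.symm

lemma eigenvector_mem_hsSubmodule (s : ℝ) {μ : ℝ} (e : A.eigenspace μ) :
    (e : H) ∈ A.hsSubmodule s :=
  summable_of_ne_finset_zero (s := {μ}) fun ν hν => by
    rw [A.proj_eigenvector_of_ne (by simpa using hν) e, norm_zero]
    ring

/-- An eigenvector of `A`, as an element of `ℋ^s`. -/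
def eigenHs (s : ℝ) {μ : ℝ} (e : A.eigenspace μ) : A.Hs s :=
  ⟨e, A.eigenvector_mem_hsSubmodule s e⟩

@[simp] lemma val_eigenHs (s : ℝ) {μ : ℝ} (e : A.eigenspace μ) : (A.eigenHs s e).val = e := rfl

variable {A}

lemma Hs.val_injective {s : ℝ} : Function.Injective (Hs.val : A.Hs s → H) :=
  Subtype.val_injective

lemma Hs.inner_eigenvector_toLp {s μ : ℝ} (e : A.eigenspace μ) (x : A.Hs s) :
    ⟪(e : H), Hs.toLp x μ⟫_𝕜 = (((1 + μ ^ 2) ^ (s / 2) : ℝ) : 𝕜) * ⟪(e : H), x.val⟫_𝕜 := by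
  show ⟪(e : H), A.coords s x.val μ⟫_𝕜 = _
  rw [coords, inner_smul_right, A.inner_eigenvector_proj]

/-- Up to the positive weight, this reads off a single `ℓ²` coordinate. -/
lemma Hs.continuous_inner_eigenvector {s μ : ℝ} (e : A.eigenspace μ) :
    Continuous fun x : A.Hs s => ⟪(e : H), x.val⟫_𝕜 := by
  have h : (((1 + μ ^ 2) ^ (s / 2) : ℝ) : 𝕜) ≠ 0 := by
    have : (0 : ℝ) < (1 + μ ^ 2) ^ (s / 2) := by positivity
    exact_mod_cast this.ne'
  have h1 : ∀ x : A.Hs s, ⟪(e : H), x.val⟫_𝕜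
      = (((1 + μ ^ 2) ^ (s / 2) : ℝ) : 𝕜)⁻¹ * ⟪(e : H), Hs.toLp x μ⟫_𝕜 := fun x => by
    rw [Hs.inner_eigenvector_toLp, inv_mul_cancel_left₀ h]
  simp only [h1]
  have h2 : Continuous fun x : A.Hs s => Hs.toLp x μ := by
    refine AddMonoidHomClass.continuous_of_bound
      ((Pi.evalAddMonoidHom _ μ).comp ((lpSubmodule 𝕜 (fun _ : ℝ => H) 2).subtype.toAddMonoidHom.comp
        (Hs.toLp (A := A) (s := s)).toAddMonoidHom)) 1 fun x => ?_
    rw [one_mul, Hs.norm_eq]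
    exact lp.norm_apply_le_norm (by norm_num) (Hs.toLp x) μ
  fun_prop

/-- `U` and `W` are the continuous representatives of `u` and of `∂_t u` on `[0, T]`. -/
structure IsRep (T : ℝ) (u : ℝ → A.Hs 1) (U : ℝ → A.Hs (1 / 2)) (W : ℝ → A.HsNeg (1 / 2)) :
    Prop where
  memVe : A.MemVe T u
  continuousOn : ContinuousOn U (Set.Icc 0 T)
  ae_eq : ∀ᵐ t ∂(volume.restrict (Set.Ioo 0 T)), (U t).val = (u t).val
  continuousOn_deriv : ContinuousOn W (Set.Icc 0 T)
  weak_deriv : ∀ η : ℝ → ℝ, IsTest T η → ∀ x : A.Hs (1 / 2),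
      ∫ t in Set.Ioo 0 T, ((deriv η t : ℝ) : 𝕜) * ⟪x.val, (u t).val⟫_𝕜
        = -∫ t in Set.Ioo 0 T, ((η t : ℝ) : 𝕜) * W t x

namespace IsRep

variable {T μ : ℝ} {u : ℝ → A.Hs 1} {U : ℝ → A.Hs (1 / 2)} {W : ℝ → A.HsNeg (1 / 2)}

lemma continuousOn_inner (h : IsRep T u U W) (e : A.eigenspace μ) :
    ContinuousOn (fun t => ⟪(e : H), (U t).val⟫_𝕜) (Set.Icc 0 T) :=
  (Hs.continuous_inner_eigenvector e).comp_continuousOn h.continuousOn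

lemma continuousOn_apply (h : IsRep T u U W) (x : A.Hs (1 / 2)) :
    ContinuousOn (fun t => W t x) (Set.Icc 0 T) :=
  (continuous_eval_const x).comp_continuousOn h.continuousOn_deriv

lemma integral_deriv_smul (h : IsRep T u U W) (e : A.eigenspace μ) {η : ℝ → ℝ}
    (hη : IsTest T η) :
    ∫ t in Set.Ioo 0 T, deriv η t • ⟪(e : H), (U t).val⟫_𝕜
      = -∫ t in Set.Ioo 0 T, η t • W t (A.eigenHs _ e) := by
  simp only [RCLike.real_smul_eq_coe_mul]
  rw [← h.weak_deriv η hη]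
  refine integral_congr_ae ?_
  filter_upwards [h.ae_eq] with t ht
  rw [ht, val_eigenHs]

lemma hasDerivWithinAt_inner (h : IsRep T u U W) (hT : 0 < T) (e : A.eigenspace μ) :
    ∀ t ∈ Set.Icc 0 T, HasDerivWithinAt (fun t => ⟪(e : H), (U t).val⟫_𝕜)
      (W t (A.eigenHs _ e)) (Set.Icc 0 T) t :=
  hasDerivWithinAt_of_integral_isTest hT (h.continuousOn_inner e) (h.continuousOn_apply _)
    fun _ hη => h.integral_deriv_smul e hη

/-- Test the equation with `η(t) e`, where `A²e = μ²e`, and apply the first-order weak identity to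
the test function `η'`. -/
lemma hasDerivWithinAt_apply (h : IsRep T u U W) (hT : 0 < T) (e : A.eigenspace μ) :
    ∀ t ∈ Set.Icc 0 T, HasDerivWithinAt (fun t => W t (A.eigenHs _ e))
      ((μ ^ 2 : ℝ) • ⟪(e : H), (U t).val⟫_𝕜) (Set.Icc 0 T) t := by
  refine hasDerivWithinAt_of_integral_isTest hT (h.continuousOn_apply _)
    ((h.continuousOn_inner e).const_smul _) fun η hη => ?_
  have hint : ∀ {ζ : ℝ → ℝ}, IsTest T ζ →
      IntegrableOn (fun t => ζ t • ⟪(e : H), (U t).val⟫_𝕜) (Set.Ioo 0 T) := fun hζ =>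
    ((hζ.1.continuous.continuousOn.smul (h.continuousOn_inner e)).integrableOn_Icc).mono_set
      Set.Ioo_subset_Icc_self
  obtain ⟨he, he'⟩ := A.mem_eigenspace.1 e.2
  have hmem : A.op ⟨e, he⟩ ∈ A.op.domain := by
    rw [he']
    exact A.op.domain.smul_mem _ he
  have hop : A.op ⟨A.op ⟨e, he⟩, hmem⟩ = ((μ ^ 2 : ℝ) : 𝕜) • (e : H) := by
    have h1 : (⟨A.op ⟨e, he⟩, hmem⟩ : A.op.domain) = (μ : 𝕜) • ⟨e, he⟩ := Subtype.ext he'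
    rw [h1, LinearPMap.map_smul, he', smul_smul]
    push_cast
    rw [sq]
  have h2 := h.memVe.2 η hη ⟨e, he⟩ hmem
  have h3 : ∫ t in Set.Ioo 0 T, (deriv (deriv η) t • ⟪(e : H), (U t).val⟫_𝕜
      - (μ ^ 2 : ℝ) • η t • ⟪(e : H), (U t).val⟫_𝕜) = 0 := by
    rw [← h2]
    refine integral_congr_ae ?_
    filter_upwards [h.ae_eq] with t ht
    have h4 : iteratedDeriv 2 η = deriv (deriv η) := by
      rw [iteratedDeriv_succ, iteratedDeriv_one]
    rw [hop, inner_smul_left, RCLike.conj_ofReal, h4, ht]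
    simp only [RCLike.real_smul_eq_coe_mul]
    ring
  rw [integral_sub (hint hη.deriv.deriv)
    (g := fun t => (μ ^ 2 : ℝ) • η t • ⟪(e : H), (U t).val⟫_𝕜) ((hint hη).smul (μ ^ 2 : ℝ)),
    integral_smul,
    h.integral_deriv_smul e hη.deriv] at h3
  simp only [smul_comm _ (μ ^ 2 : ℝ)]
  rw [integral_smul, eq_neg_iff_add_eq_zero, add_comm, ← neg_eq_zero, ← h3]
  abel

/-- The coefficient of `∂_t u(0)` in terms of the Cauchy data at `t`. -/
lemma deriv_zero_eq (h : IsRep T u U W) (hT : 0 < T) (e : A.eigenspace μ) {t : ℝ}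
    (ht : t ∈ Set.Icc 0 T) :
    ((Real.cosh (μ * t) : ℝ) : 𝕜) * W t (A.eigenHs _ e)
      - ((Real.sinh (μ * t) : ℝ) : 𝕜) * ((μ : 𝕜) * ⟪(e : H), (U t).val⟫_𝕜)
      = W 0 (A.eigenHs _ e) := by
  -- The derivative vanishes by `y'' = μ² y`.
  have h1 := eq_of_hasDerivWithinAt_zero (F := fun t =>
    Real.cosh (μ * t) • W t (A.eigenHs _ e)
      - Real.sinh (μ * t) • ((μ : ℝ) • ⟪(e : H), (U t).val⟫_𝕜)) (T := T) (fun t ht => by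
    refine ((((hasDerivAt_cosh_mul μ t).hasDerivWithinAt).smul
      (h.hasDerivWithinAt_apply hT e t ht)).sub (((hasDerivAt_sinh_mul μ t).hasDerivWithinAt).smul
      ((h.hasDerivWithinAt_inner hT e t ht).const_smul μ))).congr_deriv ?_
    simp only [Pi.smul_apply]
    module) t ht
  simpa [RCLike.real_smul_eq_coe_mul] using h1

/-- The coefficient of `A u(0)` in terms of the Cauchy data at `t`. -/
lemma value_zero_eq (h : IsRep T u U W) (hT : 0 < T) (e : A.eigenspace μ) {t : ℝ}
    (ht : t ∈ Set.Icc 0 T) :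
    ((Real.cosh (μ * t) : ℝ) : 𝕜) * ((μ : 𝕜) * ⟪(e : H), (U t).val⟫_𝕜)
      - ((Real.sinh (μ * t) : ℝ) : 𝕜) * W t (A.eigenHs _ e)
      = (μ : 𝕜) * ⟪(e : H), (U 0).val⟫_𝕜 := by
  have h1 := eq_of_hasDerivWithinAt_zero (F := fun t =>
    Real.cosh (μ * t) • ((μ : ℝ) • ⟪(e : H), (U t).val⟫_𝕜)
      - Real.sinh (μ * t) • W t (A.eigenHs _ e)) (T := T) (fun t ht => by
    refine ((((hasDerivAt_cosh_mul μ t).hasDerivWithinAt).smul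
      ((h.hasDerivWithinAt_inner hT e t ht).const_smul μ)).sub
      (((hasDerivAt_sinh_mul μ t).hasDerivWithinAt).smul
      (h.hasDerivWithinAt_apply hT e t ht))).congr_deriv ?_
    simp only [Pi.smul_apply]
    module) t ht
  simpa [RCLike.real_smul_eq_coe_mul] using h1

/-- The two invariants are inverted using `cosh² - sinh² = 1`. Working with `μy` instead of `y`
avoids a separate case `μ = 0`. -/
lemma deriv_eq (h : IsRep T u U W) (hT : 0 < T) (e : A.eigenspace μ) {t : ℝ}
    (ht : t ∈ Set.Icc 0 T) :
    W t (A.eigenHs _ e) = ((Real.cosh (μ * t) : ℝ) : 𝕜) * W 0 (A.eigenHs _ e)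
      + ((Real.sinh (μ * t) : ℝ) : 𝕜) * ((μ : 𝕜) * ⟪(e : H), (U 0).val⟫_𝕜) := by
  have h1 : ((Real.cosh (μ * t) : ℝ) : 𝕜) ^ 2 - ((Real.sinh (μ * t) : ℝ) : 𝕜) ^ 2 = 1 := by
    exact_mod_cast Real.cosh_sq_sub_sinh_sq (μ * t)
  rw [← h.deriv_zero_eq hT e ht, ← h.value_zero_eq hT e ht]
  linear_combination (-W t (A.eigenHs _ e)) * h1

/-- The Cauchy data at `0` determine the solution. -/
lemma eqOn_of_eq_zero {u' : ℝ → A.Hs 1} {U' : ℝ → A.Hs (1 / 2)} {W' : ℝ → A.HsNeg (1 / 2)}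
    (h : IsRep T u U W) (h' : IsRep T u' U' W') (hT : 0 < T) (hU : U 0 = U' 0)
    (hW : W 0 = W' 0) : Set.EqOn U U' (Set.Icc 0 T) := by
  intro t ht
  refine Hs.val_injective (sub_eq_zero.1 (A.eq_zero_of_inner_eigenvector_eq_zero fun μ e he => ?_))
  -- Both derivatives are given by the same data at `0`, so the difference is constant; no division
  -- by `μ` is needed.
  have h1 := eq_of_hasDerivWithinAt_zero (F := fun t => ⟪e, (U t).val⟫_𝕜 - ⟪e, (U' t).val⟫_𝕜)
    (fun s hs => ((h.hasDerivWithinAt_inner hT ⟨e, he⟩ s hs).sub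
      (h'.hasDerivWithinAt_inner hT ⟨e, he⟩ s hs)).congr_deriv (by
        rw [h.deriv_eq hT _ hs, h'.deriv_eq hT _ hs, hU, hW, sub_self])) t ht
  rw [inner_sub_right, h1, hU, sub_self]

/-- The continuous representative of `u` is unique. -/
lemma eqOn {U' : ℝ → A.Hs (1 / 2)} (h : IsRep T u U W) (hT : 0 < T)
    (hU' : ContinuousOn U' (Set.Icc 0 T))
    (hae : ∀ᵐ t ∂(volume.restrict (Set.Ioo 0 T)), (U' t).val = (u t).val) :
    Set.EqOn U U' (Set.Icc 0 T) := by
  intro t ht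
  refine Hs.val_injective (sub_eq_zero.1 (A.eq_zero_of_inner_eigenvector_eq_zero fun μ e he => ?_))
  have h1 : Set.EqOn (fun t => ⟪e, (U t).val⟫_𝕜) (fun t => ⟪e, (U' t).val⟫_𝕜) (Set.Icc 0 T) := by
    refine Measure.eqOn_Icc_of_ae_eq volume hT.ne ?_ (h.continuousOn_inner ⟨e, he⟩)
      ((Hs.continuous_inner_eigenvector (⟨e, he⟩ : A.eigenspace μ)).comp_continuousOn hU')
    rw [← restrict_Ioo_eq_restrict_Icc]
    filter_upwards [h.ae_eq, hae] with t h1 h2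
    rw [h1, h2]
  rw [inner_sub_right, sub_eq_zero]
  exact h1 ht

/-- The continuous representative of `∂_t u` is unique. -/
lemma eqOn_deriv {W' : ℝ → A.HsNeg (1 / 2)} (h : IsRep T u U W) (h' : IsRep T u U W')
    (hT : 0 < T) : Set.EqOn W W' (Set.Icc 0 T) := by
  intro t ht
  ext x
  refine eqOn_Icc_of_integral_isTest hT (h.continuousOn_apply x) (h'.continuousOn_apply x)
    (fun η hη => ?_) ht
  simp only [RCLike.real_smul_eq_coe_mul]
  rw [← neg_inj, ← h.weak_deriv η hη, ← h'.weak_deriv η hη]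

end IsRep

end PosOp

/-! ### Dual spaces and their functional calculus -/

namespace PosOp

variable {𝕜 : Type*} [RCLike 𝕜] {H : Type*} [NormedAddCommGroup H] [InnerProductSpace 𝕜 H]
  [CompleteSpace H] {A : PosOp 𝕜 H} {s : ℝ}

lemma Hs.toLp_apply (x : A.Hs s) (μ : ℝ) :
    Hs.toLp x μ = (((1 + μ ^ 2) ^ (s / 2) : ℝ) : 𝕜) • A.proj μ x.val := rfl

/-- Density of the eigenvectors enters here: it makes the seminorm of `ℋ^s` a norm. -/
lemma Hs.toLp_injective : Function.Injective (Hs.toLp : A.Hs s → lp (fun _ : ℝ => H) 2) := by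
  refine (injective_iff_map_eq_zero _).2 fun x hx => Hs.val_injective ?_
  rw [map_zero]
  refine A.eq_zero_of_inner_eigenvector_eq_zero fun μ e he => ?_
  have h1 := Hs.inner_eigenvector_toLp (⟨e, he⟩ : A.eigenspace μ) x
  rw [hx, lp.coeFn_zero, Pi.zero_apply, inner_zero_right, eq_comm, mul_eq_zero] at h1
  refine h1.resolve_left ?_
  have : (0 : ℝ) < (1 + μ ^ 2) ^ (s / 2) := by positivity
  exact_mod_cast ne_of_gt this

/-- The Riesz representation of an element of `ℋ^{-s}` in spectral coordinates. -/
lemma HsNeg.exists_riesz (φ : A.HsNeg s) :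
    ∃ c : lp (fun _ : ℝ => H) 2, ∀ x, φ x = ⟪Hs.toLp x, c⟫_𝕜 := by
  let L : A.Hs s ≃ₗ[𝕜] LinearMap.range (Hs.toLp (A := A) (s := s)) :=
    LinearEquiv.ofInjective _ Hs.toLp_injective
  have hL : ∀ y, ‖L.symm y‖ = ‖y‖ := fun y => by
    obtain ⟨x, rfl⟩ := L.surjective y
    rw [L.symm_apply_apply, Hs.norm_eq]
    rfl
  -- Conjugation makes the functional linear. Hahn–Banach extends it from the image of `ℋ^s` to all
  -- of `ℓ²`, so completeness of `ℋ^s` is not needed.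
  let F : LinearMap.range (Hs.toLp (A := A) (s := s)) →L[𝕜] 𝕜 := LinearMap.mkContinuous
    { toFun := fun y => starRingEnd 𝕜 (φ (L.symm y))
      map_add' := fun y z => by simp only [map_add]
      map_smul' := fun a y => by
        simp only [map_smul, map_smulₛₗ, smul_eq_mul, map_mul, RCLike.conj_conj, RingHom.id_apply] }
    ‖φ‖ (fun y => by
      rw [← hL]
      exact (RCLike.norm_conj _).le.trans (φ.le_opNorm _))
  obtain ⟨g, hg, -⟩ := exists_extension_norm_eq _ F
  refine ⟨(InnerProductSpace.toDual 𝕜 _).symm g, fun x => ?_⟩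
  rw [← inner_conj_symm, InnerProductSpace.toDual_symm_apply]
  have h1 : g (Hs.toLp x) = starRingEnd 𝕜 (φ (L.symm (L x))) := hg (L x)
  rw [h1, L.symm_apply_apply, RCLike.conj_conj]

/-- A functional on `ℋ^s` is determined by its values on the eigenvectors of `A`. -/
lemma HsNeg.ext_eigenHs {φ ψ : A.HsNeg s}
    (h : ∀ (μ : ℝ) (e : A.eigenspace μ), φ (A.eigenHs s e) = ψ (A.eigenHs s e)) : φ = ψ := by
  have key : ∀ (χ : A.HsNeg s) (x : A.Hs s),
      χ x = ∑' μ, χ (A.eigenHs s ⟨A.proj μ x.val, A.proj_mem μ x.val⟩) := by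
    intro χ x
    obtain ⟨c, hc⟩ := χ.exists_riesz
    rw [hc, lp.inner_eq_tsum]
    refine tsum_congr fun μ => ?_
    rw [hc, lp.inner_eq_tsum, tsum_eq_single μ]
    · rw [Hs.toLp_apply, Hs.toLp_apply, val_eigenHs, A.proj_apply_of_mem (A.proj_mem μ x.val)]
    · intro ν hν
      rw [Hs.toLp_apply, val_eigenHs, A.proj_eigenvector_of_ne hν, smul_zero, inner_zero_left]
  ext x
  rw [key φ, key ψ]
  simp only [h]

lemma summable_norm_sq_lp {G : Type*} [NormedAddCommGroup G] (c : lp (fun _ : ℝ => G) 2) :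
    Summable fun μ => ‖c μ‖ ^ 2 := by
  have := (lp.memℓp c).summable (by norm_num)
  simpa using this

section Calculus

variable {m : ℝ → ℝ} (hm : ∀ μ, |m μ| ≤ 1)

lemma toLp_hsCalc (x : A.Hs s) (μ : ℝ) :
    Hs.toLp (A.hsCalc s m hm x) μ = (m μ : 𝕜) • Hs.toLp x μ := by
  have h : (A.hsCalc s m hm x).val = A.funCalc m x.val := rfl
  rw [Hs.toLp_apply, Hs.toLp_apply, h, A.proj_funCalc hm, smul_comm]

lemma hsCalc_eigenHs {μ : ℝ} (e : A.eigenspace μ) :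
    A.hsCalc s m hm (A.eigenHs s e) = (m μ : 𝕜) • A.eigenHs s e := by
  refine Hs.val_injective ?_
  show A.funCalc m (e : H) = _
  rw [map_smul, val_eigenHs, funCalc, tsum_eq_single μ, A.proj_apply_of_mem e.2]
  intro ν hν
  rw [A.proj_eigenvector_of_ne hν, smul_zero]

lemma negCalc_eigenHs (φ : A.HsNeg s) {μ : ℝ} (e : A.eigenspace μ) :
    A.negCalc s m hm φ (A.eigenHs s e) = (m μ : 𝕜) * φ (A.eigenHs s e) := by
  show φ (A.hsCalc s m hm (A.eigenHs s e)) = _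
  rw [hsCalc_eigenHs, map_smulₛₗ, RCLike.conj_ofReal, smul_eq_mul]

/-- Since `m` is real it moves across the inner product, so `m(A)φ` has Riesz coordinates `m(μ) c
μ`; Cauchy–Schwarz finishes. -/
lemma norm_negCalc_le {φ : A.HsNeg s} {c : lp (fun _ : ℝ => H) 2}
    (hc : ∀ x, φ x = ⟪Hs.toLp x, c⟫_𝕜) :
    ‖A.negCalc s m hm φ‖ ≤ Real.sqrt (∑' μ, (m μ) ^ 2 * ‖c μ‖ ^ 2) := by
  have hs : Summable fun μ => (m μ) ^ 2 * ‖c μ‖ ^ 2 :=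
    Summable.of_nonneg_of_le (fun μ => by positivity)
      (fun μ => mul_le_of_le_one_left (by positivity) ((sq_le_one_iff_abs_le_one _).2 (hm μ)))
      (summable_norm_sq_lp c)
  have hnorm : ∀ μ, ‖(m μ : 𝕜) • c μ‖ ^ 2 = (m μ) ^ 2 * ‖c μ‖ ^ 2 := fun μ => by
    rw [norm_smul, RCLike.norm_ofReal, mul_pow, sq_abs]
  let d : lp (fun _ : ℝ => H) 2 := ⟨fun μ => (m μ : 𝕜) • c μ, by
    refine (memℓp_gen_iff (by norm_num)).2 (hs.congr fun μ => ?_)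
    rw [← hnorm]
    norm_num⟩
  have hd : ‖d‖ = Real.sqrt (∑' μ, (m μ) ^ 2 * ‖c μ‖ ^ 2) := by
    have h := lp.norm_rpow_eq_tsum (p := 2) (by norm_num) d
    simp only [ENNReal.toReal_ofNat, Real.rpow_ofNat] at h
    rw [← Real.sqrt_sq (norm_nonneg d), h]
    exact congrArg _ (tsum_congr hnorm)
  rw [← hd]
  refine ContinuousLinearMap.opNorm_le_bound _ (norm_nonneg _) fun x => ?_
  have h1 : A.negCalc s m hm φ x = ⟪Hs.toLp x, d⟫_𝕜 := by
    show φ (A.hsCalc s m hm x) = _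
    rw [hc, lp.inner_eq_tsum, lp.inner_eq_tsum]
    refine tsum_congr fun μ => ?_
    rw [toLp_hsCalc, inner_smul_left, RCLike.conj_ofReal]
    exact (inner_smul_right _ _ _).symm
  rw [h1, Hs.norm_eq, mul_comm]
  exact norm_inner_le_norm _ _

end Calculus

/-- If `m_k → 0` pointwise and boundedly, then `m_k(A) → 0` strongly on `ℋ^{-s}`. -/
lemma tendsto_negCalc {m : ℕ → ℝ → ℝ} (hm : ∀ k μ, |m k μ| ≤ 1)
    (h0 : ∀ μ, Tendsto (fun k => m k μ) atTop (𝓝 0)) (φ : A.HsNeg s) :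
    Tendsto (fun k => A.negCalc s (m k) (hm k) φ) atTop (𝓝 0) := by
  obtain ⟨c, hc⟩ := φ.exists_riesz
  have h1 : Tendsto (fun k => ∑' μ, (m k μ) ^ 2 * ‖c μ‖ ^ 2) atTop (𝓝 (∑' _ : ℝ, (0 : ℝ))) := by
    -- The dominating series is `‖c μ‖²`.
    refine tendsto_tsum_of_dominated_convergence (summable_norm_sq_lp c) (fun μ => ?_)
      (Eventually.of_forall fun k μ => ?_)
    · simpa using ((h0 μ).pow 2).mul_const (‖c μ‖ ^ 2)
    · rw [Real.norm_of_nonneg (by positivity)]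
      exact mul_le_of_le_one_left (by positivity) ((sq_le_one_iff_abs_le_one _).2 (hm k μ))
  rw [tsum_zero] at h1
  have h2 := (Real.continuous_sqrt.tendsto _).comp h1
  rw [Real.sqrt_zero] at h2
  exact squeeze_zero_norm (fun k => norm_negCalc_le (hm k) hc) h2

lemma ext_eigenHs (f : A.Hs (1 / 2)) {μ : ℝ} (e : A.eigenspace μ) :
    A.ext f (A.eigenHs _ e) = (μ : 𝕜) * ⟪(e : H), f.val⟫_𝕜 := by
  show ∑' ν : ℝ, (ν : 𝕜) * ⟪A.proj ν (e : H), A.proj ν f.val⟫_𝕜 = _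
  rw [tsum_eq_single μ, A.proj_apply_of_mem e.2, A.inner_eigenvector_proj]
  intro ν hν
  rw [A.proj_eigenvector_of_ne hν, inner_zero_left, mul_zero]

/-! ### The operator `T_e` and the mixed problems -/

variable {T μ : ℝ} {f : A.Hs (1 / 2)} {g : A.HsNeg (1 / 2)}

lemma Te_eigenHs (φ : A.HsNeg (1 / 2)) (e : A.eigenspace μ) :
    A.Te T f g φ (A.eigenHs _ e) = ((Real.tanh (μ * T) ^ 2 : ℝ) : 𝕜) * φ (A.eigenHs _ e)
      + (((Real.sinh (μ * T) / Real.cosh (μ * T) ^ 2 : ℝ) : 𝕜) * ((μ : 𝕜) * ⟪(e : H), f.val⟫_𝕜)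
      + (((Real.cosh (μ * T))⁻¹ : ℝ) : 𝕜) * g (A.eigenHs _ e)) := by
  rw [Te, affinePart, add_apply, add_apply, negCalc_eigenHs,
    negCalc_eigenHs, negCalc_eigenHs, ext_eigenHs]

lemma ofReal_cosh_ne_zero (x : ℝ) : ((Real.cosh x : ℝ) : 𝕜) ≠ 0 := by
  exact_mod_cast (Real.cosh_pos x).ne'

lemma ofReal_cosh_sq (x : ℝ) :
    ((Real.cosh x : ℝ) : 𝕜) ^ 2 = 1 + ((Real.sinh x : ℝ) : 𝕜) ^ 2 := by
  have := Real.cosh_sq x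
  rw [add_comm] at this
  exact_mod_cast this

/-- The iterates of `T_e` converge to the functional that `(f, g)` determines at time `T`. -/
lemma tendsto_iterate_Te {ψ : A.HsNeg (1 / 2)}
    (hψ : ∀ (μ : ℝ) (e : A.eigenspace μ), ψ (A.eigenHs _ e)
      = ((Real.cosh (μ * T) : ℝ) : 𝕜) * g (A.eigenHs _ e)
        + ((Real.sinh (μ * T) : ℝ) : 𝕜) * ((μ : 𝕜) * ⟪(e : H), f.val⟫_𝕜))
    (φ₀ : A.HsNeg (1 / 2)) :
    Tendsto (fun k : ℕ => (A.Te T f g)^[k] φ₀) atTop (𝓝 ψ) := by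
  have hm : ∀ (k : ℕ) (μ : ℝ), |(Real.tanh (μ * T) ^ 2) ^ k| ≤ 1 := fun k μ => by
    rw [abs_pow]
    exact pow_le_one₀ (abs_nonneg _) (abs_tanh_sq_le T μ)
  -- On each eigenspace `ψ` is fixed, because `cosh² - sinh² = 1`, and the error is multiplied by
  -- `tanh²`.
  have hstep : ∀ (φ : A.HsNeg (1 / 2)) (μ : ℝ) (e : A.eigenspace μ),
      A.Te T f g φ (A.eigenHs _ e) - ψ (A.eigenHs _ e)
        = ((Real.tanh (μ * T) ^ 2 : ℝ) : 𝕜) * (φ (A.eigenHs _ e) - ψ (A.eigenHs _ e)) := by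
    intro φ μ e
    have h1 := ofReal_cosh_sq (𝕜 := 𝕜) (μ * T)
    have h2 := ofReal_cosh_ne_zero (𝕜 := 𝕜) (μ * T)
    rw [Te_eigenHs, hψ, Real.tanh_eq_sinh_div_cosh]
    push_cast
    field_simp
    linear_combination (-(((Real.cosh (μ * T) : ℝ) : 𝕜) * g (A.eigenHs _ e)
        + ((Real.sinh (μ * T) : ℝ) : 𝕜) * ((μ : 𝕜) * ⟪(e : H), f.val⟫_𝕜))) * h1
  have hiter : ∀ k : ℕ, (A.Te T f g)^[k] φ₀
      = ψ + A.negCalc (1 / 2) (fun μ => (Real.tanh (μ * T) ^ 2) ^ k) (hm k) (φ₀ - ψ) := by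
    intro k
    refine HsNeg.ext_eigenHs fun μ e => ?_
    rw [add_apply, negCalc_eigenHs, sub_apply, ← sub_eq_iff_eq_add']
    induction k with
    | zero => simp
    | succ k ih =>
      rw [Function.iterate_succ_apply', hstep, ih]
      push_cast
      ring
  simp only [hiter]
  have h3 := (tendsto_negCalc hm (fun μ => tendsto_pow_atTop_nhds_zero_of_lt_one (sq_nonneg _)
    (Real.tanh_sq_lt_one _)) (φ₀ - ψ)).const_add ψ
  rwa [add_zero] at h3

/-- In coordinates, with `p = v(T) = w(T)`: `cosh · μp = μf + sinh · φ` from `v`, and `cosh · φ₁ = g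
+ sinh · μp` from `w`. Eliminating `μp` gives the formula. -/
lemma IsStep.eq_Te (hT : 0 < T) {φ φ₁ : A.HsNeg (1 / 2)} (h : A.IsStep T f g φ φ₁) :
    φ₁ = A.Te T f g φ := by
  obtain ⟨v, w, ⟨hv, ⟨V, hVc, hVae, hV0⟩, ⟨V₁, hV₁c, hV₁w, hV₁T⟩⟩, ⟨hw, ⟨W₁, hW₁c, hW₁w, hW₁0⟩,
    p, ⟨P, hPc, hPae, hPT⟩, ⟨W, hWc, hWae, hWT⟩⟩, ⟨W₂, hW₂c, hW₂w, hW₂T⟩⟩ := h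
  have hV : IsRep T v V V₁ := ⟨hv, hVc, hVae, hV₁c, hV₁w⟩
  have hW : IsRep T w W W₁ := ⟨hw, hWc, hWae, hW₁c, hW₁w⟩
  have hW2 : IsRep T w W W₂ := ⟨hw, hWc, hWae, hW₂c, hW₂w⟩
  have hTm : T ∈ Set.Icc 0 T := ⟨hT.le, le_rfl⟩
  -- Each trace condition brings its own representative; uniqueness identifies those belonging to
  -- the same function.
  have hVT : V T = p := (hV.eqOn hT hPc hPae hTm).trans hPT
  have hW₁T : W₁ T = φ₁ := (hW.eqOn_deriv hW2 hT hTm).trans hW₂T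
  refine HsNeg.ext_eigenHs fun μ e => ?_
  have h1 := hV.value_zero_eq hT e hTm
  have h2 := hW.deriv_zero_eq hT e hTm
  rw [hVT, hV₁T, hV0] at h1
  rw [hWT, hW₁T, hW₁0] at h2
  have h4 := ofReal_cosh_ne_zero (𝕜 := 𝕜) (μ * T)
  rw [Te_eigenHs, Real.tanh_eq_sinh_div_cosh, ← h1, ← h2]
  push_cast
  field_simp
  ring

end PosOp

end CauchyElliptic

/-! ### Uniqueness of the solution and convergence of the iteration -/

theorem mainTheorem1 {𝕜 : Type*} [RCLike 𝕜] (n : ℕ) (Ω : Set (EuclideanSpace ℝ (Fin n)))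
    (hΩ : IsOpen Ω) (hΩb : Bornology.IsBounded Ω)
    (A : CauchyElliptic.PosOp 𝕜 (Lp 𝕜 2 (volume.restrict Ω)))
    (T : ℝ) (hT : 0 < T) (f : A.Hs (1 / 2)) (g : A.HsNeg (1 / 2))
    (hfg : A.IsConsistent T f g) :
    ∃ u : ℝ → A.Hs 1, A.SolvesCauchy T f g u ∧
      (∀ u', A.SolvesCauchy T f g u' → u' =ᵐ[volume.restrict (Set.Ioo 0 T)] u) ∧
      ∃ ψ : A.HsNeg (1 / 2),
        (∀ ψ', A.HasDerivTrace T u T ψ' ↔ ψ' = ψ) ∧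
        ∀ φ₀ : A.HsNeg (1 / 2),
          Tendsto (fun k : ℕ => (A.Te T f g)^[k] φ₀) atTop (𝓝 ψ) ∧
          ∀ φ : ℕ → A.HsNeg (1 / 2), φ 0 = φ₀ → (∀ k, A.IsStep T f g (φ k) (φ (k + 1))) →
            ∀ k, φ k = (A.Te T f g)^[k] φ₀ := by
  obtain ⟨u, hu, ⟨U, hUc, hUae, hU0⟩, ⟨W, hWc, hWw, hW0⟩⟩ := hfg
  have hU : CauchyElliptic.PosOp.IsRep T u U W := ⟨hu, hUc, hUae, hWc, hWw⟩
  have hTm : T ∈ Set.Icc 0 T := ⟨hT.le, le_rfl⟩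
  refine ⟨u, ⟨hu, ⟨U, hUc, hUae, hU0⟩, ⟨W, hWc, hWw, hW0⟩⟩, ?_, W T, fun ψ' => ⟨?_, ?_⟩,
    fun φ₀ => ⟨CauchyElliptic.PosOp.tendsto_iterate_Te (fun μ e => ?_) φ₀, fun φ h0 hφ k => ?_⟩⟩
  · rintro u' ⟨hu', ⟨U', hUc', hUae', hU0'⟩, ⟨W', hWc', hWw', hW0'⟩⟩
    have hU' : CauchyElliptic.PosOp.IsRep T u' U' W' := ⟨hu', hUc', hUae', hWc', hWw'⟩
    have heq := hU.eqOn_of_eq_zero hU' hT (hU0.trans hU0'.symm) (hW0.trans hW0'.symm)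
    filter_upwards [hUae, hUae', ae_restrict_mem measurableSet_Ioo] with t h1 h2 ht
    refine CauchyElliptic.PosOp.Hs.val_injective ?_
    rw [← h1, ← h2, heq (Set.Ioo_subset_Icc_self ht)]
  · rintro ⟨W', hWc', hWw', rfl⟩
    exact (hU.eqOn_deriv ⟨hu, hUc, hUae, hWc', hWw'⟩ hT hTm).symm
  · rintro rfl
    exact ⟨W, hWc, hWw, rfl⟩
  -- `∂_t u(T)` has the coordinates of the fixed point, namely those of `cosh(AT) g + sinh(AT) A f`.
  · rw [hU.deriv_eq hT e hTm, hU0, hW0]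
  · induction k with
    | zero => exact h0
    | succ k ih => rw [Function.iterate_succ_apply', ← ih, (hφ k).eq_Te hT]
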